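/- Let $R$ be a commutative ring with unit and $\Sigma$ a smooth oriented Hausdorff surface, possibly with boundary. A *generic loop* on $\Sigma$ is a piecewise smooth immersion $\alpha:S^1\to\Sigma\setminus\partial\Sigma$ (finitely many corners, without cusps and distinct from the crossings, are allowed) whose only self-crossings are double and transversal; $\#\alpha\subset\Sigma$ denotes its set of self-crossings. A *pointed loop* is a generic loop $\alpha$ with a base point $*_\alpha\in\alpha(S^1)\setminus\#\alpha$. Two pointed loops $\alpha,\beta$ are *isotopic* if $\beta=h_1\circ\alpha\circ\varphi$ and $*_\beta=h_1(*_\alpha)$ for some continuous family of homeomorphisms $h_t:\Sigma\to\Sigma$, $t\in[0,1]$, with $h_0=\mathrm{id}$, and some orientation preserving homeomorphism $\varphi$ of $S^1$. Let $\mathcal L$ be the free $R$-module on the set of isotopy classes of pointed loops; the class of $(\alpha,*_\alpha)$ is denoted by the same symbol. For a pointed loop $(\alpha,*_\alpha)$ and $p\in\#\alpha$ let $p_1,p_2\in S^1$ be the two preimages of $p$, in the order in which they are met when one starts at $\alpha^{-1}(*_\alpha)$ and moves along $S^1$ in the positive direction. Let $\alpha_{p_1,p_2}$ and $\alpha_{p_2,p_1}$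 be the loops obtained by restricting $\alpha$ to the positively oriented arcs from $p_1$ to $p_2$ and from $p_2$ to $p_1$; these are generic loops, with a corner at $p$. Let $\varepsilon_p=+1$ if the pair (tangent direction of $\alpha$ at $p_1$, tangent direction of $\alpha$ at $p_2$) is positive with respect to the orientation of $\Sigma$, and $\varepsilon_p=-1$ otherwise. Then $\#\alpha$ is finite for every pointed loop $\alpha$, and there is a unique $R$-linear map $\rho:\mathcal L\to\mathcal L\otimes_R\mathcal L$ such that for every pointed loop $(\alpha,*_\alpha)$ $$\rho(\alpha,*_\alpha)=\sum_{p\in\#\alpha}\varepsilon_p\,(\alpha_{p_1,p_2},p)\otimes(\alpha_{p_2,p_1},*_\alpha).$$ The map $\rho$ is a (left) pre-Lie comultiplication, i.e. $$(\mathrm{id}-P^{1,2})\bigl((\rho\otimes\mathrm{id})\rho-(\mathrm{id}\otimes\rho)\rho\bigr)=0,\qquad P^{1,2}(x\otimes y\otimes z)=y\otimes x\otimes z .$$ Its antisymmetrization $\nu=\rho-\mathrm{Perm}\circ\rho$, where $\mathrm{Perm}(x\otimes y)=y\otimes x$, is Turaev's Lie cobracket on $\mathcal L$: it satisfies $$\nu(\alpha,*_\alpha)=\sum_{p\in\#\alpha}\varepsilon_p\bigl((\alpha_{p_1,p_2},p)\otimes(\alpha_{p_2,p_1},*_\alpha)-(\alpha_{p_2,p_1},*_\alpha)\otimes(\alpha_{p_1,p_2},p)\bigr)$$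 for every pointed loop, and it is a Lie cobracket, i.e. $\mathrm{Perm}\circ\nu=-\nu$ and $(\mathrm{id}+\tau+\tau^2)(\mathrm{id}\otimes\nu)\nu=0$ with $\tau(x\otimes y\otimes z)=z\otimes x\otimes y$. -/

import Mathlib

open scoped Manifold ContDiff TensorProduct

noncomputable section

namespace SurfaceLoops

/-! ### Lie and pre-Lie coalgebras -/

section Coalgebra

variable {R A : Type*} [CommRing R] [AddCommGroup A] [Module R A]

/-- The permutation `x ⊗ y ↦ y ⊗ x` of `A ⊗ A`. -/
def perm (R A : Type*) [CommRing R] [AddCommGroup A] [Module R A] : A ⊗[R] A →ₗ[R] A ⊗[R] A :=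
  (TensorProduct.comm R A A).toLinearMap

/-- The permutation `x ⊗ y ⊗ z ↦ z ⊗ x ⊗ y` of `A ⊗ A ⊗ A`. -/
def tau (R A : Type*) [CommRing R] [AddCommGroup A] [Module R A] :
    A ⊗[R] (A ⊗[R] A) →ₗ[R] A ⊗[R] (A ⊗[R] A) :=
  (TensorProduct.comm R (A ⊗[R] A) A).toLinearMap ∘ₗ
    (TensorProduct.assoc R A A A).symm.toLinearMap

/-- The permutation `x ⊗ y ⊗ z ↦ y ⊗ x ⊗ z` of `A ⊗ A ⊗ A`. -/
def perm12 (R A : Type*) [CommRing R] [AddCommGroup A] [Module R A] :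
    A ⊗[R] (A ⊗[R] A) →ₗ[R] A ⊗[R] (A ⊗[R] A) :=
  (TensorProduct.leftComm R A A A).toLinearMap

/-- The antisymmetrization `ρ - Perm ∘ ρ` of a comultiplication `ρ`. -/
def antisymmetrization (ρ : A →ₗ[R] A ⊗[R] A) : A →ₗ[R] A ⊗[R] A := ρ - perm R A ∘ₗ ρ

/-- `ν` is a Lie cobracket: `Perm ∘ ν = -ν` and `(id + τ + τ²) ∘ (id ⊗ ν) ∘ ν = 0`. -/
def IsLieCobracket (ν : A →ₗ[R] A ⊗[R] A) : Prop :=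
  perm R A ∘ₗ ν = -ν ∧
    (LinearMap.id + tau R A + tau R A ∘ₗ tau R A) ∘ₗ (ν.lTensor A) ∘ₗ ν = 0

/-- `ρ` is a (left) pre-Lie comultiplication:
`(id - P¹²) ∘ ((ρ ⊗ id) ∘ ρ - (id ⊗ ρ) ∘ ρ) = 0`. -/
def IsPreLieComultiplication (ρ : A →ₗ[R] A ⊗[R] A) : Prop :=
  (LinearMap.id - perm12 R A) ∘ₗ
    ((TensorProduct.assoc R A A A).toLinearMap ∘ₗ (ρ.rTensor A) ∘ₗ ρ - (ρ.lTensor A) ∘ₗ ρ) = 0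

end Coalgebra

/-! ### Oriented surfaces -/

/-- A smooth oriented surface, possibly with boundary: a smooth manifold modelled on the closed
half-plane whose charts form an oriented atlas, i.e. all changes of coordinates have positive
Jacobian determinant. The charts of the atlas are the positively oriented ones. -/
class OrientedSurface (M : Type*) [TopologicalSpace M] [ChartedSpace (EuclideanHalfSpace 2) M] :
    Prop extends IsManifold (𝓡∂ 2) ∞ M where
  det_pos : ∀ e ∈ atlas (EuclideanHalfSpace 2) M, ∀ e' ∈ atlas (EuclideanHalfSpace 2) M,
    ∀ y ∈ ((e.extend (𝓡∂ 2)).symm ≫ e'.extend (𝓡∂ 2)).source,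
      0 < (fderivWithin ℝ (e'.extend (𝓡∂ 2) ∘ (e.extend (𝓡∂ 2)).symm)
        (Set.range (𝓡∂ 2)) y).det

/-! ### Maps from the circle -/

section Circle

variable {M : Type*}

/-- A map from the circle `ℝ / ℤ`, viewed as a `1`-periodic curve. -/
def curve (f : UnitAddCircle → M) (t : ℝ) : M := f (t : UnitAddCircle)

/-- The self-crossings of a map from the circle. -/
def crossings (f : UnitAddCircle → M) : Set M := {p | ∃ x y, x ≠ y ∧ f x = p ∧ f y = p}

/-- The map of the circle `u ↦ f (a + (b - a) u)`, `u ∈ [0, 1)`: the restriction of the loop `f` to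
the arc from `a` to `b`, closed up. -/
def arcMap (f : UnitAddCircle → M) (a b : ℝ) : UnitAddCircle → M :=
  Function.Periodic.lift (f := fun u : ℝ => curve f (a + (b - a) * Int.fract u))
    (c := (1 : ℝ)) (fun u => by simp)

theorem curve_arcMap (f : UnitAddCircle → M) (a b u : ℝ) :
    curve (arcMap f a b) u = curve f (a + (b - a) * Int.fract u) := rfl

theorem curve_add_int (f : UnitAddCircle → M) (t : ℝ) (n : ℤ) :
    curve f (t + n) = curve f t := by
  simp [curve]

theorem coe_eq_coe_iff (s t : ℝ) :
    (s : UnitAddCircle) = t ↔ ∃ n : ℤ, t = s + n := by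
  rw [eq_comm, ← sub_eq_zero, ← AddCircle.coe_sub, AddCircle.coe_eq_zero_iff]
  constructor
  · rintro ⟨n, hn⟩
    exact ⟨n, by simp at hn; linarith⟩
  · rintro ⟨n, hn⟩
    exact ⟨n, by simp [hn]⟩

theorem exists_rep (a : ℝ) (x : UnitAddCircle) :
    ∃ t : ℝ, a ≤ t ∧ t < a + 1 ∧ (t : UnitAddCircle) = x := by
  induction x using QuotientAddGroup.induction_on with
  | H t =>
    refine ⟨a + Int.fract (t - a), by linarith [Int.fract_nonneg (t - a)],
      by linarith [Int.fract_lt_one (t - a)], ?_⟩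
    exact (coe_eq_coe_iff _ _).2 ⟨⌊t - a⌋, by rw [Int.fract]; ring⟩

theorem eq_of_coe_eq {a s t : ℝ} (hs : a ≤ s) (hs' : s < a + 1) (ht : a ≤ t) (ht' : t < a + 1)
    (h : (s : UnitAddCircle) = t) : s = t := by
  obtain ⟨n, hn⟩ := (coe_eq_coe_iff s t).1 h
  have h1 : (n : ℝ) < 1 := by linarith
  have h2 : (-1 : ℝ) < n := by linarith
  have h3 : n = 0 := by
    have h1' : n < 1 := by exact_mod_cast h1
    have h2' : -1 < n := by exact_mod_cast h2
    omega
  simp [hn, h3]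

/-- The affine parameter change. -/
def aff (a b : ℝ) (n : ℤ) (u : ℝ) : ℝ := a + (b - a) * (u - n)

theorem crossings_arcMap {f : UnitAddCircle → M} {a b : ℝ} (hab : a < b) {q : M}
    (hq : q ∈ crossings (arcMap f a b)) :
    ∃ s t : ℝ, a ≤ s ∧ s < t ∧ t < b ∧ curve f s = q ∧ curve f t = q := by
  obtain ⟨x, y, hxy, hx, hy⟩ := hq
  obtain ⟨s, hs1, hs2, rfl⟩ := exists_rep 0 x
  obtain ⟨t, ht1, ht2, rfl⟩ := exists_rep 0 y
  have key : ∀ u : ℝ, 0 ≤ u → u < 0 + 1 → arcMap f a b u = q → curve f (a + (b - a) * u) = q := by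
    intro u hu1 hu2 hu
    rw [← hu]
    change _ = curve f (a + (b - a) * Int.fract u)
    rw [Int.fract_eq_self.2 ⟨hu1, by linarith⟩]
  have hst : s ≠ t := fun e => hxy (by rw [e])
  rcases lt_or_gt_of_ne hst with h | h
  · exact ⟨_, _, by nlinarith, by nlinarith, by nlinarith, key s hs1 hs2 hx, key t ht1 ht2 hy⟩
  · exact ⟨_, _, by nlinarith, by nlinarith, by nlinarith, key t ht1 ht2 hy, key s hs1 hs2 hx⟩

theorem curve_arcMap_right (f : UnitAddCircle → M) (a b u : ℝ) :
    curve (arcMap f a b) =ᶠ[nhdsWithin u (Set.Ici u)] curve f ∘ aff a b ⌊u⌋ := by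
  filter_upwards [self_mem_nhdsWithin,
    mem_nhdsWithin_of_mem_nhds (Iio_mem_nhds (Int.lt_floor_add_one u))] with x hx hx'
  have : ⌊x⌋ = ⌊u⌋ :=
    Int.floor_eq_iff.2 ⟨(Int.floor_le u).trans hx, hx'⟩
  rw [curve_arcMap, Int.fract, this]
  rfl

theorem curve_arcMap_left {f : UnitAddCircle → M} {a b : ℝ} (h : curve f a = curve f b) (u : ℝ) :
    curve (arcMap f a b) =ᶠ[nhdsWithin u (Set.Iic u)] curve f ∘ aff a b (⌈u⌉ - 1) := by
  have hlt : ((⌈u⌉ - 1 : ℤ) : ℝ) < u := by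
    have := Int.ceil_lt_add_one u
    push_cast
    linarith
  filter_upwards [self_mem_nhdsWithin,
    mem_nhdsWithin_of_mem_nhds (Ioi_mem_nhds hlt)] with x hx hx'
  rcases lt_or_ge x (⌈u⌉ : ℝ) with h1 | h1
  · have : ⌊x⌋ = ⌈u⌉ - 1 :=
      Int.floor_eq_iff.2 ⟨le_of_lt hx', by push_cast; linarith⟩
    rw [curve_arcMap, Int.fract, this]
    rfl
  · have hxu : x = (⌈u⌉ : ℝ) := le_antisymm (le_trans hx (Int.le_ceil u)) h1
    rw [curve_arcMap, hxu, Int.fract_intCast, mul_zero, add_zero, h]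
    simp [aff]

theorem curve_arcMap_nhds {f : UnitAddCircle → M} {a b u : ℝ} (hu : (⌊u⌋ : ℝ) ≠ u) :
    curve (arcMap f a b) =ᶠ[nhds u] curve f ∘ aff a b ⌊u⌋ := by
  filter_upwards [Iio_mem_nhds (Int.lt_floor_add_one u),
    Ioi_mem_nhds (lt_of_le_of_ne (Int.floor_le u) hu)] with x hx hx'
  have : ⌊x⌋ = ⌊u⌋ := Int.floor_eq_iff.2 ⟨le_of_lt hx', hx⟩
  rw [curve_arcMap, Int.fract, this]
  rfl

end Circle

/-! ### Generic loops -/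

section Loops

variable {M : Type*} [TopologicalSpace M] [ChartedSpace (EuclideanHalfSpace 2) M]

/-- The curve `ℝ → M` is smooth at `t`. -/
def SmoothAt (c : ℝ → M) (t : ℝ) : Prop :=
  ContMDiffAt 𝓘(ℝ, ℝ) (𝓡∂ 2) ∞ c t

/-- The velocity of a curve relative to the parameter set `s` at the parameter `t`, a tangent
vector at `c t`, written in the coordinates of the preferred chart at `c t`. -/
def velWithin (c : ℝ → M) (s : Set ℝ) (t : ℝ) : EuclideanSpace ℝ (Fin 2) :=
  mfderivWithin 𝓘(ℝ, ℝ) (𝓡∂ 2) c s t (1 : ℝ)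

/-- The two-sided velocity. -/
def vel (c : ℝ → M) (t : ℝ) : EuclideanSpace ℝ (Fin 2) :=
  mfderiv 𝓘(ℝ, ℝ) (𝓡∂ 2) c t (1 : ℝ)

/-- The velocity from the right. -/
def velRight (c : ℝ → M) (t : ℝ) : EuclideanSpace ℝ (Fin 2) := velWithin c (Set.Ici t) t

/-- The velocity from the left. -/
def velLeft (c : ℝ → M) (t : ℝ) : EuclideanSpace ℝ (Fin 2) := velWithin c (Set.Iic t) t

/-- A generic loop on `M`: a (piecewise) smooth immersion of the circle in the interior of `M`,
having only double transversal self-crossings. Finitely many corners, distinct from the crossings,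
are allowed; at a corner the two one-sided velocities are not opposite (no cusps). -/
structure IsGenericLoop (f : UnitAddCircle → M) : Prop where
  interior : ∀ x, (𝓡∂ 2).IsInteriorPoint (f x)
  smooth_right : ∀ t, ContMDiffWithinAt 𝓘(ℝ, ℝ) (𝓡∂ 2) ∞ (curve f) (Set.Ici t) t
  smooth_left : ∀ t, ContMDiffWithinAt 𝓘(ℝ, ℝ) (𝓡∂ 2) ∞ (curve f) (Set.Iic t) t
  finite_corners : {x | ∃ t : ℝ, (t : UnitAddCircle) = x ∧ ¬ SmoothAt (curve f) t}.Finite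
  velRight_ne_zero : ∀ t, velRight (curve f) t ≠ 0
  velLeft_ne_zero : ∀ t, velLeft (curve f) t ≠ 0
  no_cusp : ∀ t, ∀ r : ℝ, 0 < r → velRight (curve f) t ≠ -(r • velLeft (curve f) t)
  double : ∀ x y z, f x = f y → f y = f z → x = y ∨ y = z ∨ x = z
  crossing_smooth : ∀ s t : ℝ, (s : UnitAddCircle) ≠ t → curve f s = curve f t →
    SmoothAt (curve f) s ∧ SmoothAt (curve f) t
  transversal : ∀ s t : ℝ, (s : UnitAddCircle) ≠ t → curve f s = curve f t →
    LinearIndependent ℝ ![vel (curve f) s, vel (curve f) t]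

/-! ### The loop running along an arc between the two preimages of a crossing -/

theorem contMDiff_aff (a b : ℝ) (n : ℤ) : ContMDiff 𝓘(ℝ, ℝ) 𝓘(ℝ, ℝ) ∞ (aff a b n) := by
  apply ContDiff.contMDiff
  unfold aff
  fun_prop

theorem velWithin_of_aff {c d : ℝ → M} {a b : ℝ} {n : ℤ} {u : ℝ} {S T : Set ℝ}
    (hu : u ∈ S) (hS : UniqueDiffWithinAt ℝ S u) (hST : Set.MapsTo (aff a b n) S T)
    (hc : ContMDiffWithinAt 𝓘(ℝ, ℝ) (𝓡∂ 2) ∞ c T (aff a b n u))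
    (h : d =ᶠ[nhdsWithin u S] c ∘ aff a b n) :
    ContMDiffWithinAt 𝓘(ℝ, ℝ) (𝓡∂ 2) ∞ d S u ∧
      velWithin d S u = (b - a) • velWithin c T (aff a b n u) := by
  have hux : d u = (c ∘ aff a b n) u := h.self_of_nhdsWithin hu
  have haff : ContMDiffWithinAt 𝓘(ℝ, ℝ) 𝓘(ℝ, ℝ) ∞ (aff a b n) S u :=
    (contMDiff_aff a b n).contMDiffAt.contMDiffWithinAt
  refine ⟨(hc.comp u haff hST).congr_of_eventuallyEq h hux, ?_⟩
  have h0 : (∞ : WithTop ℕ∞) ≠ 0 := by simp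
  have hd : HasMFDerivWithinAt 𝓘(ℝ, ℝ) (𝓡∂ 2) (c ∘ aff a b n) S u
      ((mfderivWithin 𝓘(ℝ, ℝ) (𝓡∂ 2) c T (aff a b n u)).comp
        (ContinuousLinearMap.toSpanSingleton ℝ (b - a) : ℝ →L[ℝ] ℝ)) := by
    refine HasMFDerivWithinAt.comp u (hc.mdifferentiableWithinAt h0).hasMFDerivWithinAt ?_ hST
    refine HasFDerivWithinAt.hasMFDerivWithinAt ?_
    have : HasDerivAt (aff a b n) (b - a) u := by
      have := (((hasDerivAt_id u).sub_const (n : ℝ)).const_mul (b - a)).const_add a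
      rw [mul_one] at this
      exact this
    exact this.hasDerivWithinAt.hasFDerivWithinAt
  have hd' := (hd.congr_of_eventuallyEq h hux).mfderivWithin hS.uniqueMDiffWithinAt
  unfold velWithin
  rw [hd']
  change mfderivWithin 𝓘(ℝ, ℝ) (𝓡∂ 2) c T (aff a b n u)
    (ContinuousLinearMap.toSpanSingleton ℝ (b - a) (1 : ℝ)) = _
  rw [ContinuousLinearMap.toSpanSingleton_apply, smul_eq_mul, one_mul]
  have h1 : (b - a) • (1 : ℝ) = b - a := by rw [smul_eq_mul, mul_one]
  have h2 := (mfderivWithin 𝓘(ℝ, ℝ) (𝓡∂ 2) c T (aff a b n u)).map_smul (b - a) (1 : ℝ)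
  exact (congrArg (mfderivWithin 𝓘(ℝ, ℝ) (𝓡∂ 2) c T (aff a b n u)) h1).symm.trans h2

theorem mapsTo_aff_Ici {a b : ℝ} (hab : a < b) (n : ℤ) (u : ℝ) :
    Set.MapsTo (aff a b n) (Set.Ici u) (Set.Ici (aff a b n u)) := by
  intro x hx
  simp only [Set.mem_Ici, aff] at *
  nlinarith

theorem mapsTo_aff_Iic {a b : ℝ} (hab : a < b) (n : ℤ) (u : ℝ) :
    Set.MapsTo (aff a b n) (Set.Iic u) (Set.Iic (aff a b n u)) := by
  intro x hx
  simp only [Set.mem_Iic, aff] at *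
  nlinarith

theorem vel_eq_velWithin (c : ℝ → M) (t : ℝ) : vel c t = velWithin c Set.univ t := by
  have : mfderivWithin 𝓘(ℝ, ℝ) (𝓡∂ 2) c Set.univ t = mfderiv 𝓘(ℝ, ℝ) (𝓡∂ 2) c t := by
    rw [mfderivWithin_univ]
  exact (congrArg (fun L => L (1 : ℝ)) this).symm

theorem velRight_eq_vel {c : ℝ → M} {t : ℝ} (h : SmoothAt c t) : velRight c t = vel c t := by
  have := mfderivWithin_eq_mfderiv (uniqueDiffOn_Ici t t Set.self_mem_Ici).uniqueMDiffWithinAt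
    (ContMDiffAt.mdifferentiableAt h (by simp))
  exact congrArg (fun L => L (1 : ℝ)) this

theorem velLeft_eq_vel {c : ℝ → M} {t : ℝ} (h : SmoothAt c t) : velLeft c t = vel c t := by
  have := mfderivWithin_eq_mfderiv (uniqueDiffOn_Iic t t Set.self_mem_Iic).uniqueMDiffWithinAt
    (ContMDiffAt.mdifferentiableAt h (by simp))
  exact congrArg (fun L => L (1 : ℝ)) this

theorem smoothAt_arcMap {f : UnitAddCircle → M} {a b u : ℝ} (hu : (⌊u⌋ : ℝ) ≠ u)
    (hc : SmoothAt (curve f) (aff a b ⌊u⌋ u)) :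
    SmoothAt (curve (arcMap f a b)) u ∧
      vel (curve (arcMap f a b)) u = (b - a) • vel (curve f) (aff a b ⌊u⌋ u) := by
  rw [vel_eq_velWithin, vel_eq_velWithin]
  exact velWithin_of_aff (Set.mem_univ u) uniqueDiffWithinAt_univ (Set.mapsTo_univ _ _)
    hc (by rw [nhdsWithin_univ]; exact curve_arcMap_nhds hu)

theorem aff_floor (a b u : ℝ) : aff a b ⌊u⌋ u = a + (b - a) * Int.fract u := rfl

/-- Closing up the arc of a generic loop between the two preimages of a crossing gives a generic
loop, with a corner at the crossing. -/
theorem IsGenericLoop.arc {f : UnitAddCircle → M} (hf : IsGenericLoop f) {a b : ℝ} (hab : a < b)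
    (hb : b < a + 1) (h : curve f a = curve f b) : IsGenericLoop (arcMap f a b) := by
  have hk : 0 < b - a := sub_pos.2 hab
  have hne : (a : UnitAddCircle) ≠ b := fun e =>
    hab.ne (eq_of_coe_eq le_rfl (by linarith) hab.le hb e)
  have hR : ∀ t, ContMDiffWithinAt 𝓘(ℝ, ℝ) (𝓡∂ 2) ∞ (curve (arcMap f a b)) (Set.Ici t) t ∧
      velRight (curve (arcMap f a b)) t = (b - a) • velRight (curve f) (aff a b ⌊t⌋ t) := fun t =>
    velWithin_of_aff Set.self_mem_Ici (uniqueDiffOn_Ici t t Set.self_mem_Ici)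
      (mapsTo_aff_Ici hab _ _) (hf.smooth_right _) (curve_arcMap_right f a b t)
  have hL : ∀ t, ContMDiffWithinAt 𝓘(ℝ, ℝ) (𝓡∂ 2) ∞ (curve (arcMap f a b)) (Set.Iic t) t ∧
      velLeft (curve (arcMap f a b)) t = (b - a) • velLeft (curve f) (aff a b (⌈t⌉ - 1) t) :=
    fun t => velWithin_of_aff Set.self_mem_Iic (uniqueDiffOn_Iic t t Set.self_mem_Iic)
      (mapsTo_aff_Iic hab _ _) (hf.smooth_left _) (curve_arcMap_left h t)
  have hmem : ∀ t : ℝ, a ≤ aff a b ⌊t⌋ t ∧ aff a b ⌊t⌋ t < b := fun t => by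
    rw [aff_floor]
    constructor
    · nlinarith [Int.fract_nonneg t]
    · nlinarith [Int.fract_lt_one t]
  have hinj : ∀ s t : ℝ, (aff a b ⌊s⌋ s : UnitAddCircle) = aff a b ⌊t⌋ t →
      (s : UnitAddCircle) = t := by
    intro s t e
    have e1 := eq_of_coe_eq (hmem s).1 (by linarith [(hmem s).2]) (hmem t).1
      (by linarith [(hmem t).2]) e
    rw [aff_floor, aff_floor] at e1
    have e2 : Int.fract s = Int.fract t := by
      have := add_left_cancel e1
      exact mul_left_cancel₀ hk.ne' this
    refine (coe_eq_coe_iff s t).2 ⟨⌊t⌋ - ⌊s⌋, ?_⟩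
    push_cast
    simp only [Int.fract] at e2
    linarith
  -- at a crossing of the arc, neither parameter is an end point of the arc
  have hend : ∀ s t : ℝ, (s : UnitAddCircle) ≠ t →
      curve (arcMap f a b) s = curve (arcMap f a b) t → (⌊s⌋ : ℝ) ≠ s := by
    intro s t hst e hs
    have hs0 : aff a b ⌊s⌋ s = a := by simp [aff, hs]
    have e' : curve f (aff a b ⌊s⌋ s) = curve f (aff a b ⌊t⌋ t) := e
    rw [hs0] at e'
    have hta : (aff a b ⌊t⌋ t : UnitAddCircle) ≠ a := fun ee =>
      hst (hinj s t (by rw [hs0, ee]))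
    have htb : (aff a b ⌊t⌋ t : UnitAddCircle) ≠ b := fun ee =>
      (hmem t).2.ne (eq_of_coe_eq (hmem t).1 (by linarith [(hmem t).2]) hab.le hb ee)
    rcases hf.double (aff a b ⌊t⌋ t : UnitAddCircle) a b e'.symm h with h1 | h1 | h1
    · exact hta h1
    · exact hne h1
    · exact htb h1
  have hcross : ∀ s t : ℝ, (s : UnitAddCircle) ≠ t →
      curve (arcMap f a b) s = curve (arcMap f a b) t →
      (aff a b ⌊s⌋ s : UnitAddCircle) ≠ aff a b ⌊t⌋ t := fun s t hst _ e => hst (hinj s t e)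
  refine ⟨?_, fun t => (hR t).1, fun t => (hL t).1, ?_, ?_, ?_, ?_, ?_, ?_, ?_⟩
  · intro x
    obtain ⟨t, -, -, rfl⟩ := exists_rep 0 x
    exact hf.interior _
  · have hfin : {s : ℝ | s ∈ Set.Ico a (a + 1) ∧ ¬ SmoothAt (curve f) s}.Finite :=
      Set.Finite.of_injOn (f := fun s : ℝ => (s : UnitAddCircle))
        (by rintro s ⟨-, hs⟩; exact ⟨s, rfl, hs⟩)
        (fun s hs t ht e => eq_of_coe_eq hs.1.1 hs.1.2 ht.1.1 ht.1.2 e) hf.finite_corners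
    refine ((hfin.image fun s => (((s - a) / (b - a) : ℝ) : UnitAddCircle)).insert 0).subset ?_
    rintro x ⟨t, hx, ht⟩
    subst hx
    by_cases hi : (⌊t⌋ : ℝ) = t
    · left
      exact ((coe_eq_coe_iff 0 t).2 ⟨⌊t⌋, by rw [zero_add, hi]⟩).symm
    · right
      refine ⟨aff a b ⌊t⌋ t, ⟨⟨(hmem t).1, by linarith [(hmem t).2]⟩,
        fun hs => ht (smoothAt_arcMap hi hs).1⟩, ?_⟩
      refine (coe_eq_coe_iff _ _).2 ⟨⌊t⌋, ?_⟩
      rw [aff]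
      field_simp
      ring
  · intro t
    rw [(hR t).2]
    exact smul_ne_zero hk.ne' (hf.velRight_ne_zero _)
  · intro t
    rw [(hL t).2]
    exact smul_ne_zero hk.ne' (hf.velLeft_ne_zero _)
  · intro t r hr
    rw [(hR t).2, (hL t).2]
    intro e
    have e1 : velRight (curve f) (aff a b ⌊t⌋ t) =
        -(r • velLeft (curve f) (aff a b (⌈t⌉ - 1) t)) := by
      apply smul_right_injective _ hk.ne'
      simp only
      rw [e, smul_neg, smul_comm]
    by_cases hi : (⌊t⌋ : ℝ) = t
    · have h1 : aff a b ⌊t⌋ t = a := by simp [aff, hi]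
      have h2 : aff a b (⌈t⌉ - 1) t = b := by
        have : ⌈t⌉ = ⌊t⌋ := by rw [← hi, Int.ceil_intCast, Int.floor_intCast]
        rw [aff, this]
        push_cast
        rw [hi]
        ring
      have h3 := hf.crossing_smooth a b hne h
      have h4 := hf.transversal a b hne h
      rw [h1, h2, velRight_eq_vel h3.1, velLeft_eq_vel h3.2] at e1
      rw [LinearIndependent.pair_iff] at h4
      have h5 := h4 1 r (by rw [e1, one_smul, neg_add_cancel])
      exact one_ne_zero h5.1
    · have : ⌈t⌉ - 1 = ⌊t⌋ := by
        have hlt : (⌊t⌋ : ℝ) < t := lt_of_le_of_ne (Int.floor_le t) hi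
        have : ⌈t⌉ = ⌊t⌋ + 1 :=
          Int.ceil_eq_iff.2 ⟨by push_cast; linarith, by push_cast; exact (Int.lt_floor_add_one t).le⟩
        omega
      rw [this] at e1
      exact hf.no_cusp _ r hr e1
  · intro x y z hxy hyz
    obtain ⟨s, -, -, rfl⟩ := exists_rep 0 x
    obtain ⟨t, -, -, rfl⟩ := exists_rep 0 y
    obtain ⟨u, -, -, rfl⟩ := exists_rep 0 z
    rcases hf.double (aff a b ⌊s⌋ s : UnitAddCircle) (aff a b ⌊t⌋ t) (aff a b ⌊u⌋ u)
      hxy hyz with h1 | h1 | h1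
    · exact Or.inl (hinj _ _ h1)
    · exact Or.inr (Or.inl (hinj _ _ h1))
    · exact Or.inr (Or.inr (hinj _ _ h1))
  · intro s t hst e
    have := hf.crossing_smooth _ _ (hcross s t hst e) e
    exact ⟨(smoothAt_arcMap (hend s t hst e) this.1).1,
      (smoothAt_arcMap (hend t s hst.symm e.symm) this.2).1⟩
  · intro s t hst e
    have h1 := hf.crossing_smooth _ _ (hcross s t hst e) e
    have h2 := hf.transversal _ _ (hcross s t hst e) e
    rw [(smoothAt_arcMap (hend s t hst e) h1.1).2,
      (smoothAt_arcMap (hend t s hst.symm e.symm) h1.2).2]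
    rw [LinearIndependent.pair_iff] at h2 ⊢
    intro x y hxy
    rw [smul_smul, smul_smul] at hxy
    obtain ⟨h3, h4⟩ := h2 _ _ hxy
    exact ⟨(mul_eq_zero.1 h3).resolve_right hk.ne', (mul_eq_zero.1 h4).resolve_right hk.ne'⟩

/-! ### Pointed loops -/

/-- A pointed loop: a generic loop with a base point on it that is not a crossing. -/
structure PointedLoop (M : Type*) [TopologicalSpace M]
    [ChartedSpace (EuclideanHalfSpace 2) M] where
  toFun : UnitAddCircle → M
  generic : IsGenericLoop toFun
  base : M
  base_mem : base ∈ Set.range toFun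
  base_not_mem : base ∉ crossings toFun

/-- A homeomorphism of the circle `ℝ / ℤ` preserves the orientation if it lifts to an increasing
bijection of `ℝ`. -/
def OrientationPreserving (φ : UnitAddCircle ≃ₜ UnitAddCircle) : Prop :=
  ∃ g : ℝ ≃o ℝ, ∀ t : ℝ, φ (t : UnitAddCircle) = (g t : UnitAddCircle)

/-- Two pointed loops are isotopic if they can be obtained from each other by an ambient isotopy
and/or a reparametrization: `β = h₁ ∘ α ∘ φ` and `∗_β = h₁ (∗_α)`. -/
def Isotopic (α β : PointedLoop M) : Prop :=
  ∃ (h : unitInterval → M ≃ₜ M) (φ : UnitAddCircle ≃ₜ UnitAddCircle),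
    Continuous (fun q : unitInterval × M => h q.1 q.2) ∧
    h 0 = Homeomorph.refl M ∧
    OrientationPreserving φ ∧
    (∀ x, β.toFun x = h 1 (α.toFun (φ x))) ∧
    β.base = h 1 α.base

theorem Isotopic.refl (α : PointedLoop M) : Isotopic α α :=
  ⟨fun _ => Homeomorph.refl M, Homeomorph.refl _, continuous_snd, rfl,
    ⟨OrderIso.refl ℝ, fun _ => rfl⟩, fun _ => rfl, rfl⟩

theorem Isotopic.symm {α β : PointedLoop M} : Isotopic α β → Isotopic β α := by
  rintro ⟨h, φ, hc, h0, ⟨g, hg⟩, hα, hb⟩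
  refine ⟨fun s => (h 1).symm.trans (h (unitInterval.symm s)), φ.symm, ?_, ?_,
    ⟨g.symm, fun t => ?_⟩, fun x => ?_, ?_⟩
  · exact hc.comp ((unitInterval.continuous_symm.comp continuous_fst).prodMk
      ((h 1).symm.continuous.comp continuous_snd))
  · ext x
    simp
  · rw [Homeomorph.symm_apply_eq, hg, OrderIso.apply_symm_apply]
  · simp [hα, h0]
  · simp [hb, h0]

theorem Isotopic.trans {α β γ : PointedLoop M} :
    Isotopic α β → Isotopic β γ → Isotopic α γ := by
  rintro ⟨h, φ, hc, h0, ⟨g, hg⟩, hα, hb⟩ ⟨h', φ', hc', h0', ⟨g', hg'⟩, hα', hb'⟩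
  refine ⟨fun s => (h s).trans (h' s), φ'.trans φ, ?_, ?_, ⟨g'.trans g, fun t => ?_⟩,
    fun x => ?_, ?_⟩
  · exact hc'.comp (continuous_fst.prodMk hc)
  · ext x
    simp [h0, h0']
  · simp [hg, hg']
  · simp [hα, hα']
  · simp [hb, hb']

/-- Isotopy of pointed loops as an equivalence relation. -/
def isotopySetoid (M : Type*) [TopologicalSpace M] [ChartedSpace (EuclideanHalfSpace 2) M] :
    Setoid (PointedLoop M) :=
  ⟨Isotopic, Isotopic.refl, Isotopic.symm, Isotopic.trans⟩

/-- The set of isotopy classes of pointed loops. -/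
def IsotopyClass (M : Type*) [TopologicalSpace M] [ChartedSpace (EuclideanHalfSpace 2) M] :
    Type _ :=
  Quotient (isotopySetoid M)

/-- The free `R`-module `𝓛` on the isotopy classes of pointed loops. -/
def LoopModule (R M : Type*) [CommRing R] [TopologicalSpace M]
    [ChartedSpace (EuclideanHalfSpace 2) M] : Type _ :=
  IsotopyClass M →₀ R

instance (R M : Type*) [CommRing R] [TopologicalSpace M] [ChartedSpace (EuclideanHalfSpace 2) M] :
    AddCommGroup (LoopModule R M) :=
  inferInstanceAs (AddCommGroup (IsotopyClass M →₀ R))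

instance (R M : Type*) [CommRing R] [TopologicalSpace M] [ChartedSpace (EuclideanHalfSpace 2) M] :
    Module R (LoopModule R M) :=
  inferInstanceAs (Module R (IsotopyClass M →₀ R))

namespace PointedLoop

/-- The basis element of `𝓛` given by a pointed loop. -/
def gen (R : Type*) [CommRing R] (α : PointedLoop M) : LoopModule R M :=
  (Finsupp.single (Quotient.mk (isotopySetoid M) α) 1 : IsotopyClass M →₀ R)

variable (α : PointedLoop M)

theorem exists_baseParam : ∃ t : ℝ, curve α.toFun t = α.base := by
  obtain ⟨x, hx⟩ := α.base_mem
  obtain ⟨t, -, -, rfl⟩ := exists_rep 0 x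
  exact ⟨t, hx⟩

/-- A parameter of the base point; it is unique up to adding an integer. -/
def baseParam : ℝ := α.exists_baseParam.choose

theorem curve_baseParam : curve α.toFun α.baseParam = α.base := α.exists_baseParam.choose_spec

theorem exists_params (p : crossings α.toFun) : ∃ st : ℝ × ℝ,
    α.baseParam < st.1 ∧ st.1 < st.2 ∧ st.2 < α.baseParam + 1 ∧
      curve α.toFun st.1 = p ∧ curve α.toFun st.2 = p := by
  obtain ⟨p, x, y, hxy, hx, hy⟩ := p
  obtain ⟨s, hs1, hs2, rfl⟩ := exists_rep α.baseParam x
  obtain ⟨t, ht1, ht2, rfl⟩ := exists_rep α.baseParam y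
  have hb : p ≠ α.base := by
    rintro rfl
    exact α.base_not_mem ⟨_, _, hxy, hx, hy⟩
  have hs : α.baseParam ≠ s := by
    rintro e
    exact hb (by rw [← hx, ← α.curve_baseParam, e]; rfl)
  have ht : α.baseParam ≠ t := by
    rintro e
    exact hb (by rw [← hy, ← α.curve_baseParam, e]; rfl)
  have hst : s ≠ t := fun e => hxy (by rw [e])
  rcases lt_or_gt_of_ne hst with h | h
  · exact ⟨(s, t), lt_of_le_of_ne hs1 hs, h, ht2, hx, hy⟩
  · exact ⟨(t, s), lt_of_le_of_ne ht1 ht, h, hs2, hy, hx⟩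

/-- The parameter `p₁` at which the loop, starting at the base point, first meets `p`. -/
def param₁ (p : crossings α.toFun) : ℝ := (α.exists_params p).choose.1

/-- The parameter `p₂` at which the loop, starting at the base point, meets `p` again. -/
def param₂ (p : crossings α.toFun) : ℝ := (α.exists_params p).choose.2

theorem params_spec (p : crossings α.toFun) : α.baseParam < α.param₁ p ∧
    α.param₁ p < α.param₂ p ∧ α.param₂ p < α.baseParam + 1 ∧
      curve α.toFun (α.param₁ p) = p ∧ curve α.toFun (α.param₂ p) = p :=
  (α.exists_params p).choose_spec

/-- The sign `ε_p`: it is `+1` if the velocities of the loop at `p₁` and `p₂` form a positive basis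
of the tangent plane at `p` (recall that the charts of the surface are positively oriented), and
`-1` otherwise. -/
def sign (p : crossings α.toFun) : ℤ :=
  if 0 < vel (curve α.toFun) (α.param₁ p) 0 * vel (curve α.toFun) (α.param₂ p) 1 -
      vel (curve α.toFun) (α.param₁ p) 1 * vel (curve α.toFun) (α.param₂ p) 0
  then 1 else -1

/-- The pointed loop `(α_{p₁,p₂}, p)`. -/
def inner (p : crossings α.toFun) : PointedLoop M where
  toFun := arcMap α.toFun (α.param₁ p) (α.param₂ p)
  generic := by
    obtain ⟨h1, h2, h3, h4, h5⟩ := α.params_spec p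
    exact α.generic.arc h2 (by linarith) (h4.trans h5.symm)
  base := p
  base_mem := by
    obtain ⟨h1, h2, h3, h4, h5⟩ := α.params_spec p
    refine ⟨((0 : ℝ) : UnitAddCircle), ?_⟩
    change curve (arcMap α.toFun (α.param₁ p) (α.param₂ p)) 0 = p
    rw [curve_arcMap, Int.fract_zero, mul_zero, add_zero, h4]
  base_not_mem := by
    obtain ⟨h1, h2, h3, h4, h5⟩ := α.params_spec p
    intro hp
    obtain ⟨s, t, hs, hst, ht, hs', ht'⟩ := crossings_arcMap h2 hp
    rcases α.generic.double (s : UnitAddCircle) t (α.param₂ p) (hs'.trans ht'.symm)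
      (ht'.trans h5.symm) with e | e | e
    · exact hst.ne (eq_of_coe_eq (a := α.baseParam) (by linarith) (by linarith) (by linarith)
        (by linarith) e)
    · exact ht.ne (eq_of_coe_eq (a := α.baseParam) (by linarith) (by linarith) (by linarith)
        (by linarith) e)
    · exact (hst.trans ht).ne (eq_of_coe_eq (a := α.baseParam) (by linarith) (by linarith)
        (by linarith) (by linarith) e)

/-- The pointed loop `(α_{p₂,p₁}, ∗_α)`; its arc runs from `p₂` through the base point to the next
occurrence `p₁ + 1` of `p₁`. -/
def outer (p : crossings α.toFun) : PointedLoop M where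
  toFun := arcMap α.toFun (α.param₂ p) (α.param₁ p + 1)
  generic := by
    obtain ⟨h1, h2, h3, h4, h5⟩ := α.params_spec p
    refine α.generic.arc (by linarith) (by linarith) ?_
    have := curve_add_int α.toFun (α.param₁ p) 1
    rw [Int.cast_one] at this
    rw [this, h4, h5]
  base := α.base
  base_mem := by
    obtain ⟨h1, h2, h3, h4, h5⟩ := α.params_spec p
    refine ⟨(((α.baseParam + 1 - α.param₂ p) / (α.param₁ p + 1 - α.param₂ p) : ℝ) :
      UnitAddCircle), ?_⟩
    change curve (arcMap _ _ _) _ = _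
    have hk : 0 < α.param₁ p + 1 - α.param₂ p := by linarith
    rw [curve_arcMap, Int.fract_eq_self.2
      ⟨div_nonneg (by linarith) hk.le, (div_lt_one hk).2 (by linarith)⟩,
      mul_div_cancel₀ _ hk.ne', add_sub_cancel]
    have := curve_add_int α.toFun α.baseParam 1
    rw [Int.cast_one] at this
    rw [this, curve_baseParam]
  base_not_mem := by
    obtain ⟨h1, h2, h3, h4, h5⟩ := α.params_spec p
    intro hp
    obtain ⟨s, t, hs, hst, ht, hs', ht'⟩ :=
      crossings_arcMap (a := α.param₂ p) (b := α.param₁ p + 1) (by linarith) hp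
    refine α.base_not_mem ⟨(s : UnitAddCircle), t, fun e => hst.ne ?_, hs', ht'⟩
    exact eq_of_coe_eq (a := α.param₂ p) hs (by linarith) (by linarith) (by linarith) e

end PointedLoop

end Loops

end SurfaceLoops

end

/-! Finiteness. Pairs of distinct parameters with the same image form a subset of the compact torus;
were it infinite, it would accumulate. It cannot do so at a crossing, where transversality isolates
the pair (`IsGenericLoop.eventually_ne`), nor on the diagonal, where the absence of cusps makes the
loop injective even at corners (`IsGenericLoop.eventually_injective`), nor at any other point,
because the surface is Hausdorff.

Invariance under isotopy. An ambient isotopy carries along the crossings, the order of their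
parameters after the base point, and the two arcs. The signs are the difficulty: they are defined by
velocities, while the isotopy consists of mere homeomorphisms. For the two branches `a`, `b` through
a crossing, the map `(u, v) ↦ a u - b v`, read in a positive chart, has an isolated zero at the
origin. Its derivative has columns `a'` and `-b'`, so its index, the winding number along small
circles, is minus the sign. The index survives homotopies that keep the zero isolated, hence
increasing changes of parameters. It also survives changes of chart: a `C¹` map with positive
Jacobian acts on small differences as multiplication by a nonzero complex number, up to a relative
error below one, and Rouché's argument applies. Following the index along the isotopy gives
`crossSign_eq_of_isotopy`.

Pre-Lie identity. Both iterated coproducts are sums over ordered pairs of crossings. A pair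
contributes according to the position of the arcs from first to second passage. If the arc of `p` is
nested in that of `q`, then cutting at `q` first and at `p` first yields the same three loops, so a
term of `(ρ ⊗ id) ρ` cancels one of `(id ⊗ ρ) ρ` (`leftTerm_eq_rightTerm`). Linked arcs contribute
nothing. Disjoint arcs leave two terms of `(id ⊗ ρ) ρ`, which the exchange of the first two factors
swaps (`perm12_rightTerm`). All loops are compared through the periodic set of parameters they run
over (`Traverses`).

Lie identity. It is formal: the cyclic sum of `(id ⊗ ν) ν` is the cyclic sum of the pre-Lie
expression, up to sign. -/

namespace SurfaceLoops

open Filter Topology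

/-! ### Winding numbers -/

/-- The closed curve `γ : ℝ → ℂ \ {0}`, of period `2π`, has winding number `n` about `0`. -/
def HasWinding (γ : ℝ → ℂ) (n : ℤ) : Prop :=
  ∃ L : ℝ → ℂ, Continuous L ∧ (∀ θ, Complex.exp (L θ) = γ θ) ∧
    ∀ θ, L (θ + 2 * Real.pi) = L θ + n * (2 * Real.pi * Complex.I)

/-- Two logarithms of the same curve differ by an integer multiple of `2πi`; the integer depends
continuously on `θ`, hence is constant. -/
theorem HasWinding.unique {γ : ℝ → ℂ} {n m : ℤ} (hn : HasWinding γ n) (hm : HasWinding γ m) :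
    n = m := by
  obtain ⟨L, hL, hLe, hLp⟩ := hn
  obtain ⟨K, hK, hKe, hKp⟩ := hm
  have h : ∀ θ, ∃ k : ℤ, L θ = K θ + k * (2 * Real.pi * Complex.I) := fun θ =>
    Complex.exp_eq_exp_iff_exists_int.1 ((hLe θ).trans (hKe θ).symm)
  choose k hk using h
  have hpi : (2 * Real.pi * Complex.I : ℂ) ≠ 0 := Complex.two_pi_I_ne_zero
  have hre : ∀ θ, (k θ : ℝ) = ((L θ - K θ) / (2 * Real.pi * Complex.I)).re := by
    intro θ
    rw [hk θ, add_sub_cancel_left, mul_div_cancel_right₀ _ hpi, Complex.intCast_re]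
  have hkc : Continuous k := by
    rw [Int.isClosedEmbedding_coe_real.isEmbedding.continuous_iff]
    have : (Int.cast ∘ k : ℝ → ℝ) = fun θ => ((L θ - K θ) / (2 * Real.pi * Complex.I)).re :=
      funext hre
    rw [this]
    exact Complex.continuous_re.comp ((hL.sub hK).div_const _)
  have h0 : k (0 + 2 * Real.pi) = k 0 := PreconnectedSpace.constant inferInstance hkc
  have h1 := hk (0 + 2 * Real.pi)
  rw [hLp, hKp, h0, hk 0] at h1
  have h2 : (n : ℂ) * (2 * Real.pi * Complex.I) = m * (2 * Real.pi * Complex.I) := by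
    linear_combination h1
  exact_mod_cast mul_right_cancel₀ hpi h2

theorem HasWinding.continuous {γ : ℝ → ℂ} {n : ℤ} (h : HasWinding γ n) : Continuous γ := by
  obtain ⟨L, hL, hLe, -⟩ := h
  rw [show γ = fun θ => Complex.exp (L θ) from funext fun θ => (hLe θ).symm]
  exact Complex.continuous_exp.comp hL

theorem HasWinding.ne_zero {γ : ℝ → ℂ} {n : ℤ} (h : HasWinding γ n) (θ : ℝ) : γ θ ≠ 0 := by
  obtain ⟨L, -, hLe, -⟩ := h
  rw [← hLe]
  exact Complex.exp_ne_zero _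

theorem HasWinding.periodic {γ : ℝ → ℂ} {n : ℤ} (h : HasWinding γ n) :
    Function.Periodic γ (2 * Real.pi) := by
  intro θ
  obtain ⟨L, -, hLe, hLp⟩ := h
  rw [← hLe, ← hLe, hLp]
  exact Complex.exp_eq_exp_iff_exists_int.2 ⟨n, rfl⟩

/-- Rouché's argument: the quotient `γ' / γ` stays in the unit disc about `1`, so its principal
logarithm is continuous and periodic, and adding it to a logarithm of `γ` does not change the
increment. -/
theorem HasWinding.of_close {γ γ' : ℝ → ℂ} {n : ℤ} (h : HasWinding γ n) (hc : Continuous γ')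
    (hp : Function.Periodic γ' (2 * Real.pi)) (hlt : ∀ θ, ‖γ' θ - γ θ‖ < ‖γ θ‖) :
    HasWinding γ' n := by
  have hγ := h.continuous
  have hγ0 := h.ne_zero
  have hγp := h.periodic
  obtain ⟨L, hL, hLe, hLp⟩ := h
  have hs : ∀ θ, γ' θ / γ θ ∈ Complex.slitPlane := by
    intro θ
    have : γ' θ / γ θ = 1 + (γ' θ - γ θ) / γ θ := by
      field_simp [hγ0 θ]
      ring
    rw [this]
    apply Complex.mem_slitPlane_of_norm_lt_one
    rw [norm_div, div_lt_one (norm_pos_iff.2 (hγ0 θ))]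
    exact hlt θ
  refine ⟨fun θ => L θ + Complex.log (γ' θ / γ θ), ?_, fun θ => ?_, fun θ => ?_⟩
  · exact hL.add ((hc.div hγ hγ0).clog hs)
  · rw [Complex.exp_add, hLe, Complex.exp_log (Complex.slitPlane_ne_zero (hs θ)),
      mul_div_cancel₀ _ (hγ0 θ)]
  · simp only [hLp, hp θ, hγp θ]
    ring

theorem HasWinding.const_mul {γ : ℝ → ℂ} {n : ℤ} (h : HasWinding γ n) {z : ℂ} (hz : z ≠ 0) :
    HasWinding (fun θ => z * γ θ) n := by
  obtain ⟨L, hL, hLe, hLp⟩ := h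
  refine ⟨fun θ => Complex.log z + L θ, continuous_const.add hL, fun θ => ?_, fun θ => ?_⟩
  · rw [Complex.exp_add, Complex.exp_log hz, hLe]
  · simp only [hLp, add_assoc]

theorem hasWinding_exp (n : ℤ) : HasWinding (fun θ => Complex.exp (n * (θ * Complex.I))) n :=
  ⟨_, by fun_prop, fun θ => rfl, fun θ => by push_cast; ring⟩

/-- Periodicity reduces `θ` to a compact interval, where nearby curves are uniformly close; thus the
winding number is locally constant in the homotopy parameter. -/
theorem hasWinding_of_homotopy {X : Type*} [TopologicalSpace X] {s : Set X} (hs : IsPreconnected s)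
    {Γ : X → ℝ → ℂ} (hc : ContinuousOn (Function.uncurry Γ) (s ×ˢ Set.univ))
    (h0 : ∀ x ∈ s, ∀ θ, Γ x θ ≠ 0) (hp : ∀ x ∈ s, Function.Periodic (Γ x) (2 * Real.pi))
    {n : ℤ} {x y : X} (hx : x ∈ s) (hy : y ∈ s) (h : HasWinding (Γ x) n) :
    HasWinding (Γ y) n := by
  have : PreconnectedSpace s := isPreconnected_iff_preconnectedSpace.1 hs
  have hc' : Continuous fun q : s × ℝ => Γ q.1 q.2 :=
    hc.comp_continuous (f := fun q : s × ℝ => ((q.1 : X), q.2))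
      ((continuous_subtype_val.comp continuous_fst).prodMk continuous_snd)
      fun q => ⟨q.1.2, Set.mem_univ _⟩
  have hcx : ∀ x : s, Continuous (Γ x) := fun x => hc'.comp (Continuous.prodMk_right x)
  -- The factor `2` makes closeness usable in both directions: the distance is then also smaller
  -- than `‖Γ y θ‖`.
  have key : ∀ x : s, ∀ᶠ y : s in 𝓝 x, ∀ θ, 2 * ‖Γ y θ - Γ x θ‖ < ‖Γ x θ‖ := by
    intro x
    have h1 : ∀ᶠ y : s in 𝓝 x, ∀ θ ∈ Set.Icc 0 (2 * Real.pi), 2 * ‖Γ y θ - Γ x θ‖ < ‖Γ x θ‖ := by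
      apply isCompact_Icc.eventually_forall_of_forall_eventually
      intro θ _
      have hopen : IsOpen {q : s × ℝ | 2 * ‖Γ q.1 q.2 - Γ x q.2‖ < ‖Γ x q.2‖} := by
        have h2 : Continuous fun q : s × ℝ => Γ x q.2 := (hcx x).comp continuous_snd
        exact isOpen_lt (continuous_const.mul (hc'.sub h2).norm) h2.norm
      refine hopen.mem_nhds ?_
      simp [h0 x x.2 θ]
    filter_upwards [h1] with y hy θ
    have hpq : Function.Periodic (fun θ => (Γ y θ, Γ x θ)) (2 * Real.pi) := fun θ => by
      simp only [hp y y.2 θ, hp x x.2 θ]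
    obtain ⟨θ', hθ', e⟩ := hpq.exists_mem_Ico₀ Real.two_pi_pos θ
    rw [Prod.mk.injEq] at e
    rw [e.1, e.2]
    exact hy θ' ⟨hθ'.1, hθ'.2.le⟩
  have hiff : ∀ x : s, ∀ᶠ y : s in 𝓝 x, (HasWinding (Γ y) n ↔ HasWinding (Γ x) n) := by
    intro x
    filter_upwards [key x] with y hy
    constructor
    · intro h
      refine h.of_close (hcx x) (hp x x.2) fun θ => ?_
      have h1 := hy θ
      have h2 := norm_sub_norm_le (Γ x θ) (Γ y θ)
      rw [norm_sub_rev] at h1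
      linarith [norm_nonneg (Γ x θ - Γ y θ)]
    · intro h
      refine h.of_close (hcx y) (hp y y.2) fun θ => ?_
      linarith [hy θ, norm_nonneg (Γ y θ - Γ x θ)]
  have hloc : IsLocallyConstant fun x : s => HasWinding (Γ x) n :=
    (IsLocallyConstant.iff_eventually_eq _).2 fun x => (hiff x).mono fun _ => propext
  exact (hloc.apply_eq_of_preconnectedSpace ⟨x, hx⟩ ⟨y, hy⟩).mp h

/-- Split the real-linear map into its complex-linear part `z` and its antilinear part `w`. The
determinant is `‖z‖² - ‖w‖²`, so its sign decides which of `z e^{iθ}` and `w e^{-iθ}` dominates, and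
the curve winds like the dominant one. -/
theorem hasWinding_linear {A B : ℂ} :
    (0 < A.re * B.im - A.im * B.re → HasWinding (fun θ => Real.cos θ * A + Real.sin θ * B) 1) ∧
    (A.re * B.im - A.im * B.re < 0 →
      HasWinding (fun θ => Real.cos θ * A + Real.sin θ * B) (-1)) := by
  set z : ℂ := (A - Complex.I * B) / 2 with hz
  set w : ℂ := (A + Complex.I * B) / 2 with hw
  have hd : Complex.normSq z - Complex.normSq w = A.re * B.im - A.im * B.re := by
    simp [hz, hw, Complex.normSq_apply]
    ring
  have hA : A = z + w := by rw [hz, hw]; ring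
  have hB : B = Complex.I * (z - w) := by
    rw [hz, hw]
    linear_combination B * Complex.I_sq
  have he : ∀ θ : ℝ, Real.cos θ * A + Real.sin θ * B =
      z * Complex.exp ((1 : ℤ) * (θ * Complex.I)) +
        w * Complex.exp ((-1 : ℤ) * (θ * Complex.I)) := by
    intro θ
    have h1 : Complex.exp ((1 : ℤ) * (θ * Complex.I)) = Real.cos θ + Real.sin θ * Complex.I := by
      rw [Int.cast_one, one_mul, Complex.exp_mul_I, Complex.ofReal_cos, Complex.ofReal_sin]
    have h2 : Complex.exp ((-1 : ℤ) * (θ * Complex.I)) =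
        Real.cos θ - Real.sin θ * Complex.I := by
      rw [Int.cast_neg, Int.cast_one, neg_one_mul, ← neg_mul, Complex.exp_mul_I, Complex.cos_neg,
        Complex.sin_neg, Complex.ofReal_cos, Complex.ofReal_sin]
      ring
    rw [h1, h2, hA, hB]
    ring
  have hn : ∀ (n : ℤ) (θ : ℝ), ‖Complex.exp (n * (θ * Complex.I))‖ = 1 := by
    intro n θ
    rw [← mul_assoc]
    exact_mod_cast Complex.norm_exp_ofReal_mul_I (n * θ)
  have hcont : Continuous fun θ : ℝ => (Real.cos θ * A + Real.sin θ * B : ℂ) := by fun_prop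
  have hper : Function.Periodic (fun θ : ℝ => (Real.cos θ * A + Real.sin θ * B : ℂ))
      (2 * Real.pi) := fun θ => by simp only [Real.cos_add_two_pi, Real.sin_add_two_pi]
  rw [← hd, Complex.normSq_eq_norm_sq, Complex.normSq_eq_norm_sq]
  constructor
  · intro h
    have hlt : ‖w‖ < ‖z‖ := lt_of_pow_lt_pow_left₀ 2 (norm_nonneg _) (by linarith)
    have hz0 : z ≠ 0 := norm_pos_iff.1 ((norm_nonneg _).trans_lt hlt)
    refine ((hasWinding_exp 1).const_mul hz0).of_close hcont hper fun θ => ?_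
    rw [he, add_sub_cancel_left, norm_mul, norm_mul, hn, hn, mul_one, mul_one]
    exact hlt
  · intro h
    have hlt : ‖z‖ < ‖w‖ := lt_of_pow_lt_pow_left₀ 2 (norm_nonneg _) (by linarith)
    have hz0 : w ≠ 0 := norm_pos_iff.1 ((norm_nonneg _).trans_lt hlt)
    refine ((hasWinding_exp (-1)).const_mul hz0).of_close hcont hper fun θ => ?_
    rw [he, add_sub_cancel_right, norm_mul, norm_mul, hn, hn, mul_one, mul_one]
    exact hlt

/-! ### The index of an isolated zero of a map of the plane -/

/-- The curve obtained by restricting `F` to the circle of radius `r` about the origin. -/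
noncomputable def circleCurve (F : ℝ × ℝ → ℂ) (r θ : ℝ) : ℂ := F (r * Real.cos θ, r * Real.sin θ)

/-- The map `F` has index `n` at the origin: its restriction to small circles has winding number
`n`. -/
def HasIndex (F : ℝ × ℝ → ℂ) (n : ℤ) : Prop :=
  ∀ᶠ r in 𝓝[>] (0 : ℝ), HasWinding (circleCurve F r) n

theorem HasIndex.unique {F : ℝ × ℝ → ℂ} {n m : ℤ} (hn : HasIndex F n) (hm : HasIndex F m) :
    n = m := by
  obtain ⟨r, h1, h2⟩ := (hn.and hm).exists
  exact h1.unique h2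

theorem circleCurve_periodic (F : ℝ × ℝ → ℂ) (r : ℝ) :
    Function.Periodic (circleCurve F r) (2 * Real.pi) := fun θ => by
  simp only [circleCurve, Real.cos_add_two_pi, Real.sin_add_two_pi]

theorem circle_mem_closedBall {r R : ℝ} (hr : 0 < r) (hrR : r ≤ R) (θ : ℝ) :
    (r * Real.cos θ, r * Real.sin θ) ∈ Metric.closedBall (0 : ℝ × ℝ) R := by
  rw [mem_closedBall_zero_iff, Prod.norm_def, max_le_iff]
  simp only [Real.norm_eq_abs, abs_mul, abs_of_pos hr]
  exact ⟨(mul_le_of_le_one_right hr.le (Real.abs_cos_le_one θ)).trans hrR,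
    (mul_le_of_le_one_right hr.le (Real.abs_sin_le_one θ)).trans hrR⟩

theorem circle_ne_zero {r : ℝ} (hr : 0 < r) (θ : ℝ) :
    (r * Real.cos θ, r * Real.sin θ) ≠ (0 : ℝ × ℝ) := by
  intro h
  have h1 : r * Real.cos θ = 0 := congrArg Prod.fst h
  have h2 : r * Real.sin θ = 0 := congrArg Prod.snd h
  have h3 := (mul_eq_zero.1 h1).resolve_left hr.ne'
  have h4 := (mul_eq_zero.1 h2).resolve_left hr.ne'
  have := Real.sin_sq_add_cos_sq θ
  rw [h3, h4] at this
  norm_num at this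

/-- A property holding near the origin, the origin excepted, holds on all small circles. -/
theorem eventually_circle {P : ℝ × ℝ → Prop} (h : ∀ᶠ w in 𝓝[≠] (0 : ℝ × ℝ), P w) :
    ∀ᶠ r in 𝓝[>] (0 : ℝ), ∀ θ, P (r * Real.cos θ, r * Real.sin θ) := by
  rw [eventually_nhdsWithin_iff, Metric.nhds_basis_closedBall.eventually_iff] at h
  obtain ⟨R, hR, h⟩ := h
  filter_upwards [Ioc_mem_nhdsGT hR] with r hr θ
  exact h (circle_mem_closedBall hr.1 hr.2 θ) (circle_ne_zero hr.1 θ)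

theorem continuous_circleCurve {F : ℝ × ℝ → ℂ} (h : ∀ᶠ w in 𝓝 (0 : ℝ × ℝ), ContinuousAt F w) :
    ∀ᶠ r in 𝓝[>] (0 : ℝ), Continuous (circleCurve F r) := by
  filter_upwards [eventually_circle (h.filter_mono nhdsWithin_le_nhds)] with r hr
  rw [continuous_iff_continuousAt]
  intro θ
  exact ContinuousAt.comp (f := fun θ => (r * Real.cos θ, r * Real.sin θ)) (hr θ) (by fun_prop)

/-- The factor `z` absorbs the rotation and scaling caused by a change of chart. -/
theorem HasIndex.of_close {F G : ℝ × ℝ → ℂ} {n : ℤ} (h : HasIndex F n)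
    (hG : ∀ᶠ w in 𝓝 (0 : ℝ × ℝ), ContinuousAt G w) {z : ℂ} (hz : z ≠ 0)
    (hlt : ∀ᶠ w in 𝓝[≠] (0 : ℝ × ℝ), ‖G w - z * F w‖ < ‖z * F w‖) : HasIndex G n := by
  filter_upwards [h, continuous_circleCurve hG, eventually_circle hlt] with r h1 h2 h3
  exact (h1.const_mul hz).of_close h2 (circleCurve_periodic G r) h3

/-- The radius is treated as one more homotopy parameter, in `(0, R]`; so the winding number on a
single circle determines it on all circles and for all members of the family. -/
theorem hasIndex_of_homotopy {X : Type*} [TopologicalSpace X] {s : Set X} (hs : IsPreconnected s)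
    {F : X → ℝ × ℝ → ℂ} {R : ℝ} (hR : 0 < R)
    (hc : ContinuousOn (Function.uncurry F) (s ×ˢ Metric.closedBall 0 R))
    (h0 : ∀ x ∈ s, ∀ w ∈ Metric.closedBall 0 R, w ≠ 0 → F x w ≠ 0)
    {n : ℤ} {x y : X} (hx : x ∈ s) (hy : y ∈ s) (h : HasIndex (F x) n) : HasIndex (F y) n := by
  obtain ⟨r, h1, h2⟩ := (h.and (Ioc_mem_nhdsGT hR)).exists
  filter_upwards [Ioc_mem_nhdsGT hR] with r' hr'
  refine hasWinding_of_homotopy (s := s ×ˢ Set.Ioc 0 R) (hs.prod isPreconnected_Ioc)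
    (Γ := fun q => circleCurve (F q.1) q.2) (x := (x, r)) (y := (y, r')) ?_ ?_ ?_
    ⟨hx, h2⟩ ⟨hy, hr'⟩ h1
  · refine hc.comp (f := fun q : (X × ℝ) × ℝ =>
      (q.1.1, (q.1.2 * Real.cos q.2, q.1.2 * Real.sin q.2))) (by fun_prop) ?_
    rintro ⟨⟨a, b⟩, θ⟩ ⟨⟨ha, hb⟩, -⟩
    exact ⟨ha, circle_mem_closedBall hb.1 hb.2 θ⟩
  · rintro ⟨a, b⟩ ⟨ha, hb⟩ θ
    exact h0 a ha _ (circle_mem_closedBall hb.1 hb.2 θ) (circle_ne_zero hb.1 θ)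
  · rintro ⟨a, b⟩ -
    exact circleCurve_periodic _ _

/-- The index at the origin of a map with invertible derivative is the sign of the determinant. -/
theorem hasIndex_of_linear {F : ℝ × ℝ → ℂ} {A B : ℂ}
    (hF : ∀ᶠ w in 𝓝 (0 : ℝ × ℝ), ContinuousAt F w)
    (hd : (fun w : ℝ × ℝ => F w - (w.1 * A + w.2 * B)) =o[𝓝 0] fun w => w) {n : ℤ}
    (hn : (n = 1 ∧ 0 < A.re * B.im - A.im * B.re) ∨
      (n = -1 ∧ A.re * B.im - A.im * B.re < 0)) : HasIndex F n := by
  have hw : HasWinding (fun θ => Real.cos θ * A + Real.sin θ * B) n := by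
    rcases hn with ⟨rfl, h⟩ | ⟨rfl, h⟩
    · exact hasWinding_linear.1 h
    · exact hasWinding_linear.2 h
  -- By compactness the linear part is at least `c` on the unit circle; a remainder of at most `c /
  -- 2 * ‖w‖` is then dominated on every small circle.
  obtain ⟨c, hc, hlow⟩ : ∃ c > 0, ∀ θ : ℝ, c ≤ ‖(Real.cos θ * A + Real.sin θ * B : ℂ)‖ := by
    obtain ⟨θ₀, -, h⟩ := isCompact_Icc.exists_isMinOn (s := Set.Icc 0 (2 * Real.pi))
      ⟨0, by simp [Real.pi_pos.le]⟩ hw.continuous.norm.continuousOn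
    refine ⟨_, norm_pos_iff.2 (hw.ne_zero θ₀), fun θ => ?_⟩
    obtain ⟨θ', hθ', e⟩ := hw.periodic.exists_mem_Ico₀ Real.two_pi_pos θ
    rw [e]
    exact h ⟨hθ'.1, hθ'.2.le⟩
  have h1 : ∀ᶠ w in 𝓝 (0 : ℝ × ℝ), ‖F w - (w.1 * A + w.2 * B)‖ ≤ c / 2 * ‖w‖ :=
    hd.def (half_pos hc)
  filter_upwards [continuous_circleCurve hF, self_mem_nhdsWithin,
    eventually_circle (h1.filter_mono nhdsWithin_le_nhds)] with r h2 h3 h4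
  have hr : 0 < r := h3
  refine (hw.const_mul (z := (r : ℂ)) (by exact_mod_cast hr.ne')).of_close h2
    (circleCurve_periodic F r) fun θ => ?_
  have h5 := h4 θ
  have h6 : ‖((r * Real.cos θ, r * Real.sin θ) : ℝ × ℝ)‖ ≤ r := by
    simpa using circle_mem_closedBall hr le_rfl θ
  have h7 : (r : ℂ) * (Real.cos θ * A + Real.sin θ * B) =
      ((r * Real.cos θ : ℝ) : ℂ) * A + ((r * Real.sin θ : ℝ) : ℂ) * B := by
    push_cast; ring
  have h8 : ‖(r : ℂ) * (Real.cos θ * A + Real.sin θ * B)‖ ≥ r * c := by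
    rw [norm_mul, Complex.norm_real, Real.norm_of_nonneg hr.le]
    exact mul_le_mul_of_nonneg_left (hlow θ) hr.le
  calc _ = ‖F (r * Real.cos θ, r * Real.sin θ) -
        (((r * Real.cos θ : ℝ) : ℂ) * A + ((r * Real.sin θ : ℝ) : ℂ) * B)‖ := by
        rw [h7]; rfl
    _ ≤ c / 2 * r := h5.trans (by gcongr)
    _ < r * c := by nlinarith
    _ ≤ _ := h8

end SurfaceLoops

namespace SurfaceLoops

open Filter Topology

/-! ### Local structure of generic loops and finiteness of the crossings -/

/-- A `C¹` map on a convex set is strictly differentiable within the set. -/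
theorem exists_strict_approx {E F : Type*} [NormedAddCommGroup E] [NormedSpace ℝ E]
    [NormedAddCommGroup F] [NormedSpace ℝ F] {f : E → F} {s : Set E} {x : E}
    (hf : ContDiffWithinAt ℝ 1 f s x) (hs : Convex ℝ s) (hx : x ∈ s)
    (hu : UniqueDiffWithinAt ℝ s x) {ε : ℝ} (hε : 0 < ε) :
    ∃ t ∈ 𝓝[s] x, ∀ y ∈ t, ∀ z ∈ t, ‖f y - f z - fderivWithin ℝ f s x (y - z)‖ ≤ ε * ‖y - z‖ := by
  set L := fderivWithin ℝ f s x with hL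
  -- Once the linear part is removed, the derivative at `x` is zero, so on a small convex piece the
  -- rest is Lipschitz with any prescribed positive constant.
  have hg : ContDiffWithinAt ℝ 1 (fun y => f y - L y) s x :=
    hf.sub L.contDiff.contDiffWithinAt
  have hgL : HasFDerivWithinAt (fun y => f y - L y) (0 : E →L[ℝ] F) s x := by
    have h1 := (hf.differentiableWithinAt (by simp)).hasFDerivWithinAt
    have h2 := h1.sub (L.hasFDerivWithinAt (s := s) (x := x))
    rwa [← hL, sub_self] at h2
  rcases hg 1 le_rfl with ⟨t, hst, p, hp⟩
  rcases Metric.mem_nhdsWithin_iff.mp hst with ⟨δ, δ0, hδ⟩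
  replace hp : HasFTaylorSeriesUpToOn 1 (fun y => f y - L y) p (Metric.ball x δ ∩ insert x s) :=
    hp.mono hδ
  have hxm : x ∈ Metric.ball x δ ∩ insert x s := ⟨Metric.mem_ball_self δ0, Set.mem_insert _ _⟩
  -- The first Taylor coefficient at `x` is a derivative within the set, and unique
  -- differentiability forces it to be the zero found above.
  have hp1 : continuousMultilinearCurryFin1 ℝ E F (p x 1) = 0 := by
    have h1 := (hp.hasFDerivWithinAt (by simp) hxm)
    have h2 : HasFDerivWithinAt (fun y => f y - L y) (0 : E →L[ℝ] F)
        (Metric.ball x δ ∩ insert x s) x := by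
      rw [Set.insert_eq_of_mem hx]
      exact hgL.mono Set.inter_subset_right
    refine UniqueDiffWithinAt.eq ?_ h1 h2
    rw [Set.insert_eq_of_mem hx, Set.inter_comm]
    exact hu.inter (Metric.ball_mem_nhds _ δ0)
  have hp2 : ‖p x 1‖₊ < (⟨ε, hε.le⟩ : NNReal) := by
    have : p x 1 = 0 := (continuousMultilinearCurryFin1 ℝ E F).map_eq_zero_iff.1 hp1
    rw [this, nnnorm_zero]
    exact hε
  rw [← Set.insert_eq_of_mem (Metric.mem_ball_self δ0), ← Set.insert_inter_distrib] at hp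
  rcases hp.exists_lipschitzOnWith_of_nnnorm_lt ((convex_ball _ _).inter hs) _ hp2 with
    ⟨t, hst, hft⟩
  rw [Set.inter_comm, ← nhdsWithin_restrict' _ (Metric.ball_mem_nhds _ δ0)] at hst
  refine ⟨t, hst, fun y hy z hz => ?_⟩
  have h := hft.dist_le_mul y hy z hz
  rw [dist_eq_norm, dist_eq_norm] at h
  rw [map_sub, sub_sub_sub_comm]
  exact h

section Loops

variable {M : Type*} [TopologicalSpace M] [ChartedSpace (EuclideanHalfSpace 2) M]

theorem contDiffWithinAt_chart_comp {c : ℝ → M} {s : Set ℝ} {t : ℝ}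
    (h : ContMDiffWithinAt 𝓘(ℝ, ℝ) (𝓡∂ 2) ∞ c s t) :
    ContDiffWithinAt ℝ ∞ (fun u => extChartAt (𝓡∂ 2) (c t) (c u)) s t := by
  have := (contMDiffWithinAt_iff.1 h).2
  simpa only [Function.comp_def, extChartAt_model_space_eq_id, PartialEquiv.refl_symm,
    PartialEquiv.refl_coe, id_eq, Set.preimage_id, modelWithCornersSelf_coe, Set.range_id,
    Set.inter_univ] using this

theorem velWithin_eq {c : ℝ → M} {s : Set ℝ} {t : ℝ}
    (h : ContMDiffWithinAt 𝓘(ℝ, ℝ) (𝓡∂ 2) ∞ c s t) :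
    velWithin c s t = fderivWithin ℝ (fun u => extChartAt (𝓡∂ 2) (c t) (c u)) s t 1 := by
  have := (h.mdifferentiableWithinAt (by simp)).mfderivWithin
  unfold velWithin
  rw [this]
  simp only [Function.comp_def, writtenInExtChartAt, extChartAt_model_space_eq_id,
    PartialEquiv.refl_symm, PartialEquiv.refl_coe, id_eq, Set.preimage_id, modelWithCornersSelf_coe,
    Set.range_id, Set.inter_univ]
  rfl

theorem hasDerivAt_chart_comp {c : ℝ → M} {t : ℝ} (h : SmoothAt c t) :
    HasDerivAt (fun u => extChartAt (𝓡∂ 2) (c t) (c u)) (vel c t) t := by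
  have h' : ContMDiffWithinAt 𝓘(ℝ, ℝ) (𝓡∂ 2) ∞ c Set.univ t := h
  have h1 := contDiffWithinAt_chart_comp h'
  rw [contDiffWithinAt_univ] at h1
  have h2 := (h1.differentiableAt (by simp)).hasFDerivAt.hasDerivAt
  rw [vel_eq_velWithin, velWithin_eq h', fderivWithin_univ]
  exact h2

/-- One-sided strict differentiability of a piecewise smooth curve. -/
theorem exists_strict_approx_curve {c : ℝ → M} {s : Set ℝ} {t : ℝ}
    (h : ContMDiffWithinAt 𝓘(ℝ, ℝ) (𝓡∂ 2) ∞ c s t) (hs : Convex ℝ s) (ht : t ∈ s)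
    (hu : UniqueDiffWithinAt ℝ s t) {ε : ℝ} (hε : 0 < ε) :
    ∀ᶠ δ in 𝓝[>] (0 : ℝ), ∀ y ∈ s, |y - t| ≤ δ → ∀ z ∈ s, |z - t| ≤ δ →
      ‖extChartAt (𝓡∂ 2) (c t) (c y) - extChartAt (𝓡∂ 2) (c t) (c z) -
        (y - z) • velWithin c s t‖ ≤ ε * |y - z| := by
  obtain ⟨N, hN, hb⟩ := exists_strict_approx
    ((contDiffWithinAt_chart_comp h).of_le (by simp)) hs ht hu hε
  obtain ⟨δ₀, hδ₀, hball⟩ := Metric.mem_nhdsWithin_iff.1 hN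
  filter_upwards [Ioo_mem_nhdsGT hδ₀] with δ hδ y hy hyt z hz hzt
  have h1 := hb y (hball ⟨by rw [Metric.mem_ball, Real.dist_eq]; exact hyt.trans_lt hδ.2, hy⟩)
    z (hball ⟨by rw [Metric.mem_ball, Real.dist_eq]; exact hzt.trans_lt hδ.2, hz⟩)
  rw [velWithin_eq h]
  rw [← map_smul, smul_eq_mul, mul_one]
  exact h1

theorem IsGenericLoop.continuous_curve {f : UnitAddCircle → M} (hf : IsGenericLoop f) :
    Continuous (curve f) := by
  rw [continuous_iff_continuousAt]
  intro t
  rw [continuousAt_iff_continuous_left_right]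
  exact ⟨(hf.smooth_left t).continuousWithinAt, (hf.smooth_right t).continuousWithinAt⟩

theorem IsGenericLoop.continuous {f : UnitAddCircle → M} (hf : IsGenericLoop f) : Continuous f :=
  (QuotientAddGroup.isQuotientMap_mk (N := AddSubgroup.zmultiples (1 : ℝ))).continuous_iff.2
    hf.continuous_curve

/-- The hypotheses say that the segment from `L` to `R` misses the origin; `c` is its distance to
the origin, and homogeneity does the rest. -/
theorem exists_norm_combination_pos {E : Type*} [NormedAddCommGroup E] [NormedSpace ℝ E] {R L : E}
    (hR : R ≠ 0) (hL : L ≠ 0) (h : ∀ r : ℝ, 0 < r → R ≠ -(r • L)) :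
    ∃ c > 0, ∀ a b : ℝ, 0 ≤ a → 0 ≤ b → c * (a + b) ≤ ‖a • R + b • L‖ := by
  obtain ⟨x₀, hx₀, hmin⟩ := isCompact_Icc.exists_isMinOn (s := Set.Icc (0 : ℝ) 1)
    ⟨0, by simp⟩ (f := fun x => ‖x • R + (1 - x) • L‖) (by fun_prop)
  refine ⟨‖x₀ • R + (1 - x₀) • L‖, norm_pos_iff.2 fun e => ?_, fun a b ha hb => ?_⟩
  · rcases hx₀.1.eq_or_lt with h0 | h0
    · rw [← h0, zero_smul, zero_add, sub_zero, one_smul] at e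
      exact hL e
    · rcases hx₀.2.eq_or_lt with h1 | h1
      · rw [h1, sub_self, zero_smul, add_zero, one_smul] at e
        exact hR e
      · refine h ((1 - x₀) / x₀) (div_pos (by linarith) h0) ?_
        have e1 : x₀ • R = -((1 - x₀) • L) := eq_neg_of_add_eq_zero_left e
        rw [div_eq_inv_mul, mul_smul, ← smul_neg, ← e1, smul_smul, inv_mul_cancel₀ h0.ne',
          one_smul]
  · rcases (add_nonneg ha hb).eq_or_lt with h0 | h0
    · rw [← h0, mul_zero]
      exact norm_nonneg _
    · have h1 : a / (a + b) ∈ Set.Icc (0 : ℝ) 1 :=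
        ⟨div_nonneg ha h0.le, (div_le_one h0).2 (by linarith)⟩
      have h2 : ‖x₀ • R + (1 - x₀) • L‖ ≤ ‖(a / (a + b)) • R + (1 - a / (a + b)) • L‖ := hmin h1
      have h3 : a • R + b • L = (a + b) • ((a / (a + b)) • R + (1 - a / (a + b)) • L) := by
        rw [smul_add, smul_smul, smul_smul]
        congr 2 <;> field_simp
        ring
      rw [h3, norm_smul, Real.norm_of_nonneg h0.le, mul_comm]
      gcongr

/-- A generic loop is locally injective, also at its corners. -/
theorem IsGenericLoop.eventually_injective {f : UnitAddCircle → M} (hf : IsGenericLoop f) (t : ℝ) :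
    ∀ᶠ w : ℝ × ℝ in 𝓝 (t, t), w.1 ≠ w.2 → curve f w.1 ≠ curve f w.2 := by
  obtain ⟨c, hc, hlow⟩ := exists_norm_combination_pos (hf.velRight_ne_zero t)
    (hf.velLeft_ne_zero t) (hf.no_cusp t)
  obtain ⟨δ, ⟨hr, hl⟩, hδ⟩ := (((exists_strict_approx_curve (hf.smooth_right t) (convex_Ici t)
    Set.self_mem_Ici (uniqueDiffOn_Ici t t Set.self_mem_Ici) (half_pos hc)).and
    (exists_strict_approx_curve (hf.smooth_left t) (convex_Iic t)
    Set.self_mem_Iic (uniqueDiffOn_Iic t t Set.self_mem_Iic) (half_pos hc))).and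
    self_mem_nhdsWithin).exists
  have hδ0 : 0 < δ := hδ
  -- the main estimate, for ordered parameters
  have main : ∀ x y : ℝ, |x - t| ≤ δ → |y - t| ≤ δ → x < y → curve f x ≠ curve f y := by
    intro x y hx hy hxy e
    have ht0 : |t - t| ≤ δ := by simp [hδ0.le]
    rcases le_total t x with htx | htx
    · have h1 := hr y (htx.trans hxy.le) hy x htx hx
      rw [e, sub_self, zero_sub, norm_neg, norm_smul, Real.norm_eq_abs, mul_comm] at h1
      have h2 : c * (1 + 0) ≤ ‖(1 : ℝ) • velRight (curve f) t + (0 : ℝ) • velLeft (curve f) t‖ :=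
        hlow 1 0 zero_le_one le_rfl
      rw [one_smul, zero_smul, add_zero, add_zero, mul_one] at h2
      have h3 : 0 < |y - x| := abs_pos.2 (by linarith)
      have h4 : ‖velRight (curve f) t‖ ≤ c / 2 := le_of_mul_le_mul_right h1 h3
      linarith
    · rcases le_total y t with hty | hty
      · have h1 := hl y hty hy x htx hx
        rw [e, sub_self, zero_sub, norm_neg, norm_smul, Real.norm_eq_abs, mul_comm] at h1
        have h2 : c * (0 + 1) ≤
            ‖(0 : ℝ) • velRight (curve f) t + (1 : ℝ) • velLeft (curve f) t‖ :=
          hlow 0 1 le_rfl zero_le_one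
        rw [one_smul, zero_smul, zero_add, zero_add, mul_one] at h2
        have h3 : 0 < |y - x| := abs_pos.2 (by linarith)
        have h4 : ‖velLeft (curve f) t‖ ≤ c / 2 := le_of_mul_le_mul_right h1 h3
        linarith
      -- The parameters lie on the two sides of the corner. Adding the one-sided estimates through
      -- `t`, the displacement is the combination bounded below by `c * (y - x)`, with an error of
      -- at most half of that.
      · have h1 := hr y hty hy t Set.self_mem_Ici ht0
        have h2 := hl t Set.self_mem_Iic ht0 x htx hx
        have h3 := hlow (y - t) (t - x) (by linarith) (by linarith)
        rw [abs_of_nonneg (by linarith)] at h1 h2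
        rw [e] at h2
        have h4 := norm_add_le_of_le h1 h2
        have h5 : ∀ a b R L : EuclideanSpace ℝ (Fin 2), a - b - R + (b - a - L) = -(R + L) := by
          intros; abel
        rw [h5, norm_neg] at h4
        have h6 : c * (y - t + (t - x)) ≤ c / 2 * (y - t) + c / 2 * (t - x) := h3.trans h4
        nlinarith
  have hev : ∀ᶠ x in 𝓝 t, |x - t| ≤ δ := by
    filter_upwards [Metric.closedBall_mem_nhds t hδ0] with x hx
    rwa [Metric.mem_closedBall, Real.dist_eq] at hx
  rw [nhds_prod_eq]
  filter_upwards [hev.prod_mk hev] with w hw hne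
  rcases lt_or_gt_of_ne hne with h | h
  · exact main _ _ hw.1 hw.2 h
  · exact (main _ _ hw.2 hw.1 h).symm

/-- At a crossing, the difference of the two branches has an invertible derivative. -/
theorem IsGenericLoop.hasFDerivAt_crossing {f : UnitAddCircle → M} (hf : IsGenericLoop f) {s t : ℝ}
    (hst : (s : UnitAddCircle) ≠ t) (h : curve f s = curve f t) :
    HasFDerivAt (fun w : ℝ × ℝ => extChartAt (𝓡∂ 2) (curve f s) (curve f w.1) -
        extChartAt (𝓡∂ 2) (curve f s) (curve f w.2))
      ((ContinuousLinearMap.toSpanSingleton ℝ (vel (curve f) s)).comp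
          (ContinuousLinearMap.fst ℝ ℝ ℝ) -
        (ContinuousLinearMap.toSpanSingleton ℝ (vel (curve f) t)).comp
          (ContinuousLinearMap.snd ℝ ℝ ℝ)) (s, t) := by
  obtain ⟨hs, ht⟩ := hf.crossing_smooth s t hst h
  have h1 := (hasDerivAt_chart_comp hs).hasFDerivAt
  have h2 := (hasDerivAt_chart_comp ht).hasFDerivAt
  rw [← h] at h2
  exact (HasFDerivAt.comp (s, t) (f := Prod.fst) h1 hasFDerivAt_fst).sub
    (HasFDerivAt.comp (s, t) (f := Prod.snd) h2 hasFDerivAt_snd)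

/-- Crossings are isolated. -/
theorem IsGenericLoop.eventually_ne {f : UnitAddCircle → M} (hf : IsGenericLoop f) {s t : ℝ}
    (hst : (s : UnitAddCircle) ≠ t) (h : curve f s = curve f t) :
    ∀ᶠ w : ℝ × ℝ in 𝓝 (s, t), w ≠ (s, t) → curve f w.1 ≠ curve f w.2 := by
  have hF := hf.hasFDerivAt_crossing hst h
  set L := (ContinuousLinearMap.toSpanSingleton ℝ (vel (curve f) s)).comp
          (ContinuousLinearMap.fst ℝ ℝ ℝ) -
        (ContinuousLinearMap.toSpanSingleton ℝ (vel (curve f) t)).comp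
          (ContinuousLinearMap.snd ℝ ℝ ℝ) with hL
  have hinj : (L : ℝ × ℝ →ₗ[ℝ] EuclideanSpace ℝ (Fin 2)).ker = ⊥ := by
    rw [LinearMap.ker_eq_bot']
    rintro ⟨a, b⟩ e
    have e' : a • vel (curve f) s - b • vel (curve f) t = 0 := e
    have := LinearIndependent.pair_iff.1 (hf.transversal s t hst h) a (-b)
      (by rw [neg_smul, ← sub_eq_add_neg, e'])
    rw [this.1, neg_eq_zero.1 this.2]
    rfl
  -- An injective linear map on a finite-dimensional space is bounded below, so the difference of
  -- the branches has no other zero nearby.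
  obtain ⟨K, -, hK⟩ := LinearMap.exists_antilipschitzWith _ hinj
  have := hF.eventually_ne (c := 0) ⟨K, hK⟩
  rw [eventually_nhdsWithin_iff] at this
  filter_upwards [this] with w hw hne e
  exact hw hne (by rw [e, sub_self])

theorem eventually_nhds_coe_prod {P : UnitAddCircle × UnitAddCircle → Prop} {s t : ℝ}
    (h : ∀ᶠ w : ℝ × ℝ in 𝓝 (s, t), P (w.1, w.2)) :
    ∀ᶠ z in 𝓝 ((s : UnitAddCircle), (t : UnitAddCircle)), P z := by
  have ho : IsOpenMap (fun x : ℝ => (x : UnitAddCircle)) := QuotientAddGroup.isOpenMap_coe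
  exact (ho.prodMap ho).nhds_le (s, t) h

/-- An accumulation point of the coincidence pairs is excluded in three cases: on the diagonal, at a
crossing, and where the two images differ. -/
theorem IsGenericLoop.finite_crossings [T2Space M] {f : UnitAddCircle → M} (hf : IsGenericLoop f) :
    (crossings f).Finite := by
  have hK : {z : UnitAddCircle × UnitAddCircle | z.1 ≠ z.2 ∧ f z.1 = f z.2}.Finite := by
    by_contra hinf
    obtain ⟨⟨x, y⟩, -, hacc⟩ := Set.Infinite.exists_accPt_of_subset_isCompact hinf isCompact_univ
      (Set.subset_univ _)
    rw [accPt_iff_frequently_nhdsNE, Filter.Frequently] at hacc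
    apply hacc
    rw [eventually_nhdsWithin_iff]
    by_cases hxy : f x = f y
    · obtain ⟨s, -, -, rfl⟩ := exists_rep 0 x
      obtain ⟨t, -, -, rfl⟩ := exists_rep 0 y
      by_cases hst : (s : UnitAddCircle) = t
      · rw [← hst]
        apply eventually_nhds_coe_prod
        filter_upwards [hf.eventually_injective s] with w hw _ hz
        exact hw (fun e => hz.1 (by rw [e])) hz.2
      · apply eventually_nhds_coe_prod
        filter_upwards [hf.eventually_ne hst hxy] with w hw hne hz
        refine hw (fun e => hne ?_) hz.2
        rw [e]
        rfl
    · have h1 : ∀ᶠ z : UnitAddCircle × UnitAddCircle in 𝓝 (x, y), f z.1 ≠ f z.2 :=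
        ((hf.continuous.comp continuous_fst).continuousAt.ne_iff_eventually_ne
          (hf.continuous.comp continuous_snd).continuousAt).1 hxy
      filter_upwards [h1] with z hz _ hz'
      exact hz hz'.2
  refine (hK.image fun z => f z.1).subset ?_
  rintro p ⟨x, y, hxy, hx, hy⟩
  exact ⟨(x, y), ⟨hxy, hx.trans hy.symm⟩, hx⟩

end Loops

end SurfaceLoops

namespace SurfaceLoops

open Filter Topology

/-! ### The sign of a crossing is an isotopy invariant -/

/-- An orientation preserving real-linear map of `ℂ` is dominated by its complex-linear part. -/
theorem exists_complex_linear_part (T : ℂ →L[ℝ] ℂ) (hT : 0 < T.det) :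
    ∃ z w : ℂ, ‖w‖ < ‖z‖ ∧ ∀ v, T v = z * v + w * (starRingEnd ℂ) v := by
  -- These are the Wirtinger derivatives of `T`, with `T.det = ‖z‖² - ‖w‖²`.
  refine ⟨(T 1 - Complex.I * T Complex.I) / 2, (T 1 + Complex.I * T Complex.I) / 2, ?_, ?_⟩
  · have hd : T.det = (T 1).re * (T Complex.I).im - (T Complex.I).re * (T 1).im := by
      rw [ContinuousLinearMap.det, ← LinearMap.det_toMatrix Complex.basisOneI, Matrix.det_fin_two]
      simp [LinearMap.toMatrix_apply]
    rw [hd] at hT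
    refine lt_of_pow_lt_pow_left₀ 2 (norm_nonneg _) ?_
    rw [← Complex.normSq_eq_norm_sq, ← Complex.normSq_eq_norm_sq, ← sub_pos]
    refine hT.trans_eq ?_
    simp [Complex.normSq_apply]
    ring
  · intro v
    have h : T v = v.re * T 1 + v.im * T Complex.I := by
      have h1 : v = v.re • (1 : ℂ) + v.im • Complex.I := by
        simp
      conv_lhs => rw [h1, map_add, map_smul, map_smul]
      rw [Complex.real_smul, Complex.real_smul]
    have h1 : (starRingEnd ℂ) v = v.re - v.im * Complex.I := by
      apply Complex.ext <;> simp
    rw [h, h1]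
    nth_rw 3 [← Complex.re_add_im v]
    linear_combination ((v.im : ℂ) * T Complex.I) * Complex.I_sq

/-- The identification of the plane with `ℂ`. -/
noncomputable def toComplex : EuclideanSpace ℝ (Fin 2) ≃L[ℝ] ℂ :=
  Complex.orthonormalBasisOneI.repr.symm.toContinuousLinearEquiv

theorem norm_toComplex (v : EuclideanSpace ℝ (Fin 2)) : ‖toComplex v‖ = ‖v‖ :=
  Complex.orthonormalBasisOneI.repr.symm.norm_map v

theorem toComplex_re (v : EuclideanSpace ℝ (Fin 2)) : (toComplex v).re = v 0 := by
  change (Complex.orthonormalBasisOneI.repr.symm v).re = _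
  rw [Complex.orthonormalBasisOneI_repr_symm_apply]
  simp

theorem toComplex_im (v : EuclideanSpace ℝ (Fin 2)) : (toComplex v).im = v 1 := by
  change (Complex.orthonormalBasisOneI.repr.symm v).im = _
  rw [Complex.orthonormalBasisOneI_repr_symm_apply]
  simp

/-- An orientation preserving `C¹` map of the plane deforms small differences like a similarity,
up to a relative error less than one. -/
theorem exists_similarity_approx {ψ : EuclideanSpace ℝ (Fin 2) → EuclideanSpace ℝ (Fin 2)}
    {s : Set (EuclideanSpace ℝ (Fin 2))} {y : EuclideanSpace ℝ (Fin 2)}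
    (hψ : ContDiffWithinAt ℝ 1 ψ s y) (hs : Convex ℝ s) (hy : y ∈ s)
    (hu : UniqueDiffWithinAt ℝ s y) (hdet : 0 < (fderivWithin ℝ ψ s y).det) :
    ∃ z : ℂ, z ≠ 0 ∧ ∃ N ∈ 𝓝[s] y, ∀ a ∈ N, ∀ b ∈ N, a ≠ b →
      ‖toComplex (ψ a) - toComplex (ψ b) - z * (toComplex a - toComplex b)‖ <
        ‖z * (toComplex a - toComplex b)‖ := by
  set D := fderivWithin ℝ ψ s y with hD
  set T : ℂ →L[ℝ] ℂ := (toComplex : EuclideanSpace ℝ (Fin 2) →L[ℝ] ℂ).comp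
    (D.comp (toComplex.symm : ℂ →L[ℝ] EuclideanSpace ℝ (Fin 2))) with hT
  have hTdet : T.det = D.det :=
    LinearMap.det_conj (D : EuclideanSpace ℝ (Fin 2) →ₗ[ℝ] EuclideanSpace ℝ (Fin 2))
      toComplex.toLinearEquiv
  obtain ⟨z, w, hwz, hzw⟩ := exists_complex_linear_part T (hTdet ▸ hdet)
  have hz0 : 0 < ‖z‖ := (norm_nonneg _).trans_lt hwz
  -- With this `ε`, the linearization error and the antilinear part together stay below `‖z‖ * ‖v‖`.
  obtain ⟨N, hN, hb⟩ := exists_strict_approx (ε := (‖z‖ - ‖w‖) / 2) hψ hs hy hu (by linarith)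
  refine ⟨z, norm_pos_iff.1 hz0, N, hN, fun a ha b hb' hne => ?_⟩
  have h2 := hb a ha b hb'
  have hTv : T (toComplex (a - b)) = toComplex (D (a - b)) := by
    simp [hT]
  rw [← map_sub, ← map_sub]
  have h3 : ‖toComplex (ψ a - ψ b) - T (toComplex (a - b))‖ ≤
      (‖z‖ - ‖w‖) / 2 * ‖toComplex (a - b)‖ := by
    rw [hTv, ← map_sub, norm_toComplex, norm_toComplex]
    exact h2
  have h7 : 0 < ‖toComplex (a - b)‖ := by
    rw [norm_toComplex]
    exact norm_pos_iff.2 (sub_ne_zero.2 hne)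
  generalize toComplex (a - b) = v at *
  have h4 : toComplex (ψ a - ψ b) - z * v =
      (toComplex (ψ a - ψ b) - T v) + w * (starRingEnd ℂ) v := by
    rw [hzw]; ring
  have h5 : ‖w * (starRingEnd ℂ) v‖ = ‖w‖ * ‖v‖ := by rw [norm_mul, RCLike.norm_conj]
  have h6 := norm_add_le_of_le h3 h5.le
  rw [h4, norm_mul]
  nlinarith

/-! ### Indices of crossings in the charts of the surface -/

section Loops

variable {M : Type*} [TopologicalSpace M] [ChartedSpace (EuclideanHalfSpace 2) M]

/-- The complex coordinate in the preferred chart at `x`. -/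
noncomputable def coord (x y : M) : ℂ := toComplex (extChartAt (𝓡∂ 2) x y)

theorem continuousAt_coord {x y : M} (hy : y ∈ (chartAt (EuclideanHalfSpace 2) x).source) :
    ContinuousAt (coord x) y :=
  toComplex.continuous.continuousAt.comp (continuousAt_extChartAt' (by rwa [extChartAt_source]))

theorem injOn_coord (x : M) : Set.InjOn (coord x) (chartAt (EuclideanHalfSpace 2) x).source := by
  intro y hy z hz e
  refine (extChartAt (𝓡∂ 2) x).injOn (by rwa [extChartAt_source]) (by rwa [extChartAt_source]) ?_
  exact toComplex.injective e

/-- The transition map is `C¹` with positive Jacobian, so `exists_similarity_approx` applies; here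
the orientation of the surface enters. -/
theorem exists_coord_change [OrientedSurface M] {x x' p : M}
    (hx : p ∈ (chartAt (EuclideanHalfSpace 2) x).source)
    (hx' : p ∈ (chartAt (EuclideanHalfSpace 2) x').source) :
    ∃ z : ℂ, z ≠ 0 ∧ ∀ᶠ q : M × M in 𝓝 (p, p), q.1 ≠ q.2 →
      ‖coord x' q.1 - coord x' q.2 - z * (coord x q.1 - coord x q.2)‖ <
        ‖z * (coord x q.1 - coord x q.2)‖ := by
  have hpE : p ∈ (extChartAt (𝓡∂ 2) x).source := by rwa [extChartAt_source]
  have hpE' : p ∈ (extChartAt (𝓡∂ 2) x').source := by rwa [extChartAt_source]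
  have hy : extChartAt (𝓡∂ 2) x p ∈
      ((extChartAt (𝓡∂ 2) x).symm ≫ extChartAt (𝓡∂ 2) x').source := by
    rw [PartialEquiv.trans_source, PartialEquiv.symm_source]
    exact ⟨(extChartAt (𝓡∂ 2) x).map_source hpE,
      by rwa [Set.mem_preimage, (extChartAt (𝓡∂ 2) x).left_inv hpE]⟩
  have hrange : extChartAt (𝓡∂ 2) x p ∈ Set.range (𝓡∂ 2) := Set.mem_range_self _
  obtain ⟨z, hz, N, hN, hb⟩ := exists_similarity_approx
    ((contDiffWithinAt_ext_coord_change (n := ∞) x' x hy).of_le (by simp))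
    (𝓡∂ 2).convex_range hrange ((𝓡∂ 2).uniqueDiffOn _ hrange)
    (OrientedSurface.det_pos _ (chart_mem_atlas _ x) _ (chart_mem_atlas _ x') _ hy)
  refine ⟨z, hz, ?_⟩
  have h1 : ∀ᶠ q in 𝓝 p, q ∈ (extChartAt (𝓡∂ 2) x).source ∧ extChartAt (𝓡∂ 2) x q ∈ N :=
    (eventually_of_mem (extChartAt_source_mem_nhds' hpE) fun _ => id).and
      (extChartAt_preimage_mem_nhds_of_mem_nhdsWithin hpE hN)
  rw [nhds_prod_eq]
  filter_upwards [h1.prod_mk h1] with q hq hne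
  have h2 := hb _ hq.1.2 _ hq.2.2 fun e => hne ((extChartAt (𝓡∂ 2) x).injOn hq.1.1 hq.2.1 e)
  rwa [Function.comp_apply, Function.comp_apply, (extChartAt (𝓡∂ 2) x).left_inv hq.1.1,
    (extChartAt (𝓡∂ 2) x).left_inv hq.2.1] at h2

/-- The difference of two curves in the plane, in the chart at `x`, as a function of two
parameters. -/
noncomputable def crossMap (x : M) (a b : ℝ → M) (w : ℝ × ℝ) : ℂ :=
  coord x (a w.1) - coord x (b w.2)

theorem continuousAt_crossMap {x : M} {a b : ℝ → M} (ha : Continuous a) (hb : Continuous b)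
    {w : ℝ × ℝ} (hwa : a w.1 ∈ (chartAt (EuclideanHalfSpace 2) x).source)
    (hwb : b w.2 ∈ (chartAt (EuclideanHalfSpace 2) x).source) :
    ContinuousAt (crossMap x a b) w :=
  ((continuousAt_coord hwa).comp (f := fun w : ℝ × ℝ => a w.1) (by fun_prop)).sub
    ((continuousAt_coord hwb).comp (f := fun w : ℝ × ℝ => b w.2) (by fun_prop))

theorem eventually_continuousAt_crossMap {x : M} {a b : ℝ → M} (ha : Continuous a)
    (hb : Continuous b) (hab : a 0 = b 0)
    (hx : a 0 ∈ (chartAt (EuclideanHalfSpace 2) x).source) :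
    ∀ᶠ w in 𝓝 (0 : ℝ × ℝ), ContinuousAt (crossMap x a b) w := by
  have hU := (chartAt (EuclideanHalfSpace 2) x).open_source
  have h1 : ∀ᶠ w : ℝ × ℝ in 𝓝 0, a w.1 ∈ (chartAt (EuclideanHalfSpace 2) x).source :=
    (ha.comp continuous_fst).continuousAt.eventually (hU.mem_nhds hx)
  have h2 : ∀ᶠ w : ℝ × ℝ in 𝓝 0, b w.2 ∈ (chartAt (EuclideanHalfSpace 2) x).source :=
    (hb.comp continuous_snd).continuousAt.eventually (hU.mem_nhds (by
      rw [hab] at hx; exact hx))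
  filter_upwards [h1, h2] with w hw1 hw2
  exact continuousAt_crossMap ha hb hw1 hw2

/-- The index of the difference of two curves does not depend on the chart. -/
theorem HasIndex.chart_change [OrientedSurface M] {x x' : M} {a b : ℝ → M} (ha : Continuous a)
    (hb : Continuous b) (hab : a 0 = b 0)
    (hx : a 0 ∈ (chartAt (EuclideanHalfSpace 2) x).source)
    (hx' : a 0 ∈ (chartAt (EuclideanHalfSpace 2) x').source)
    (hne : ∀ᶠ w in 𝓝 (0 : ℝ × ℝ), w ≠ 0 → a w.1 ≠ b w.2) {n : ℤ}
    (h : HasIndex (crossMap x a b) n) : HasIndex (crossMap x' a b) n := by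
  obtain ⟨z, hz, hlt⟩ := exists_coord_change hx hx'
  refine h.of_close (eventually_continuousAt_crossMap ha hb hab hx') hz ?_
  have h1 : Tendsto (fun w : ℝ × ℝ => (a w.1, b w.2)) (𝓝 0) (𝓝 (a 0, a 0)) := by
    nth_rw 2 [hab]
    exact ((ha.comp continuous_fst).prodMk (hb.comp continuous_snd)).tendsto (0 : ℝ × ℝ)
  rw [eventually_nhdsWithin_iff]
  filter_upwards [hne, h1.eventually hlt] with w hw1 hw2 hw
  exact hw2 (hw1 hw)

/-- Since the chart is injective on its domain, branches that meet only at the origin have a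
coordinate difference with no other zero. -/
theorem hasIndex_crossMap_of_homotopy {X : Type*} [TopologicalSpace X] {S : Set X}
    (hS : IsPreconnected S) {x : M} {a b : X → ℝ → M} (ha : Continuous (Function.uncurry a))
    (hb : Continuous (Function.uncurry b)) {R : ℝ} (hR : 0 < R)
    (hx : ∀ q ∈ S, ∀ u, |u| ≤ R → a q u ∈ (chartAt (EuclideanHalfSpace 2) x).source ∧
      b q u ∈ (chartAt (EuclideanHalfSpace 2) x).source)
    (hne : ∀ q ∈ S, ∀ w ∈ Metric.closedBall (0 : ℝ × ℝ) R, w ≠ 0 → a q w.1 ≠ b q w.2)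
    {n : ℤ} {q q' : X} (hq : q ∈ S) (hq' : q' ∈ S) (h : HasIndex (crossMap x (a q) (b q)) n) :
    HasIndex (crossMap x (a q') (b q')) n := by
  have habs : ∀ w ∈ Metric.closedBall (0 : ℝ × ℝ) R, |w.1| ≤ R ∧ |w.2| ≤ R := by
    intro w hw
    rw [mem_closedBall_zero_iff, Prod.norm_def, max_le_iff] at hw
    exact hw
  refine hasIndex_of_homotopy hS (F := fun q => crossMap x (a q) (b q)) hR ?_ ?_ hq hq' h
  · rintro ⟨q, w⟩ ⟨hq, hw⟩
    apply ContinuousAt.continuousWithinAt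
    refine (ContinuousAt.comp (x := (q, w)) (f := fun y : X × (ℝ × ℝ) => a y.1 y.2.1)
      (continuousAt_coord (hx q hq _ (habs w hw).1).1) ?_).sub
      (ContinuousAt.comp (x := (q, w)) (f := fun y : X × (ℝ × ℝ) => b y.1 y.2.2)
      (continuousAt_coord (hx q hq _ (habs w hw).2).2) ?_)
    · exact (ha.comp (f := fun y : X × (ℝ × ℝ) => (y.1, y.2.1)) (by fun_prop)).continuousAt
    · exact (hb.comp (f := fun y : X × (ℝ × ℝ) => (y.1, y.2.2)) (by fun_prop)).continuousAt
  · intro q hq w hw hw0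
    rw [crossMap, sub_ne_zero]
    exact fun e => hne q hq w hw hw0
      (injOn_coord x (hx q hq _ (habs w hw).1).1 (hx q hq _ (habs w hw).2).2 e)

/-- The sign of the pair of velocities at two parameters of a loop. -/
noncomputable def crossSign (f : UnitAddCircle → M) (s t : ℝ) : ℤ :=
  if 0 < vel (curve f) s 0 * vel (curve f) t 1 - vel (curve f) s 1 * vel (curve f) t 0
  then 1 else -1

theorem IsGenericLoop.det_ne_zero {f : UnitAddCircle → M} (hf : IsGenericLoop f) {s t : ℝ}
    (hst : (s : UnitAddCircle) ≠ t) (h : curve f s = curve f t) :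
    vel (curve f) s 0 * vel (curve f) t 1 - vel (curve f) s 1 * vel (curve f) t 0 ≠ 0 := by
  intro e
  have hli := LinearIndependent.pair_iff.1 (hf.transversal s t hst h)
  set A := vel (curve f) s
  set B := vel (curve f) t
  have h1 := hli (B 1) (-A 1) (by
    ext i
    fin_cases i
    · simp; linarith
    · simp; ring)
  have h2 := hli (B 0) (-A 0) (by
    ext i
    fin_cases i
    · simp; ring
    · simp; linarith)
  have hB : B = 0 := by
    ext i
    fin_cases i
    · exact h2.1
    · exact h1.1
  have h3 := hli 0 1 (by rw [hB]; simp)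
  exact one_ne_zero h3.2

/-- The sign of a crossing as an index. -/
theorem IsGenericLoop.hasIndex {f : UnitAddCircle → M} (hf : IsGenericLoop f) {s t : ℝ}
    (hst : (s : UnitAddCircle) ≠ t) (h : curve f s = curve f t) :
    HasIndex (crossMap (curve f s) (fun u => curve f (s + u)) fun u => curve f (t + u))
      (-crossSign f s t) := by
  have hc := hf.continuous_curve
  -- The second column is minus the velocity at `t`, because the branches are subtracted; hence the
  -- index is minus the sign.
  refine hasIndex_of_linear (A := toComplex (vel (curve f) s)) (B := -toComplex (vel (curve f) t))
    (eventually_continuousAt_crossMap (by fun_prop) (by fun_prop) (by simpa using h)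
      (by simp)) ?_ ?_
  · have h1 := toComplex.hasFDerivAt.comp (s, t) (hf.hasFDerivAt_crossing hst h)
    have h2 : HasFDerivAt (fun w : ℝ × ℝ => (s + w.1, t + w.2)) (ContinuousLinearMap.id ℝ (ℝ × ℝ))
        0 := (hasFDerivAt_id (𝕜 := ℝ) (0 : ℝ × ℝ)).const_add (s, t)
    have h3 := HasFDerivAt.comp (0 : ℝ × ℝ) (f := fun w : ℝ × ℝ => (s + w.1, t + w.2))
      (by simpa using h1) h2
    have h4 := h3.isLittleO
    simp only [sub_zero] at h4
    refine h4.congr_left fun w => ?_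
    simp [crossMap, coord, h]
    ring
  · have h0 := hf.det_ne_zero hst h
    simp only [Complex.neg_re, Complex.neg_im, toComplex_re, toComplex_im]
    rw [crossSign]
    split_ifs with hpos
    · right
      exact ⟨rfl, by linarith⟩
    · left
      refine ⟨by norm_num, ?_⟩
      have := lt_of_le_of_ne (not_lt.1 hpos) h0
      linarith

/-- Increasing changes of the parameters do not affect the index of a crossing. -/
theorem IsGenericLoop.hasIndex_reparam {f : UnitAddCircle → M} (hf : IsGenericLoop f) {s t : ℝ}
    (hst : (s : UnitAddCircle) ≠ t) (h : curve f s = curve f t) {k l : ℝ → ℝ} (hk : StrictMono k)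
    (hl : StrictMono l) (hkc : Continuous k) (hlc : Continuous l) (hks : k 0 = s) (hlt : l 0 = t)
    {n : ℤ} (hn : HasIndex (crossMap (curve f s) (fun u => curve f (k u)) fun u => curve f (l u))
      n) : n = -crossSign f s t := by
  refine HasIndex.unique ?_ (hf.hasIndex hst h)
  have hc := hf.continuous_curve
  have hU := (chartAt (EuclideanHalfSpace 2) (curve f s)).open_source
  have hps := mem_chart_source (EuclideanHalfSpace 2) (curve f s)
  -- a neighbourhood of the crossing
  obtain ⟨δ, hδ, hball⟩ : ∃ δ > 0, ∀ w : ℝ × ℝ, |w.1 - s| < δ → |w.2 - t| < δ →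
      (w ≠ (s, t) → curve f w.1 ≠ curve f w.2) ∧
      curve f w.1 ∈ (chartAt (EuclideanHalfSpace 2) (curve f s)).source ∧
      curve f w.2 ∈ (chartAt (EuclideanHalfSpace 2) (curve f s)).source := by
    have h1 : ∀ᶠ w : ℝ × ℝ in 𝓝 (s, t),
        curve f w.1 ∈ (chartAt (EuclideanHalfSpace 2) (curve f s)).source :=
      (hc.comp continuous_fst).continuousAt.eventually (hU.mem_nhds hps)
    have h2 : ∀ᶠ w : ℝ × ℝ in 𝓝 (s, t),
        curve f w.2 ∈ (chartAt (EuclideanHalfSpace 2) (curve f s)).source :=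
      (hc.comp continuous_snd).continuousAt.eventually (hU.mem_nhds (by
        change curve f t ∈ _; rw [← h]; exact hps))
    obtain ⟨δ, hδ, hb⟩ := Metric.eventually_nhds_iff.1 ((hf.eventually_ne hst h).and (h1.and h2))
    refine ⟨δ, hδ, fun w hw1 hw2 => hb ?_⟩
    rw [Prod.dist_eq, max_lt_iff]
    exact ⟨hw1, hw2⟩
  obtain ⟨R, hR, hkl⟩ : ∃ R > 0, ∀ u, |u| ≤ R → |k u - s| < δ ∧ |l u - t| < δ ∧ |u| < δ := by
    have h1 : ∀ᶠ u in 𝓝 (0 : ℝ), |k u - s| < δ :=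
      (show Continuous fun u => |k u - s| by fun_prop).continuousAt.eventually_lt_const
        (by simpa [hks] using hδ)
    have h2 : ∀ᶠ u in 𝓝 (0 : ℝ), |l u - t| < δ :=
      (show Continuous fun u => |l u - t| by fun_prop).continuousAt.eventually_lt_const
        (by simpa [hlt] using hδ)
    have h3 : ∀ᶠ u in 𝓝 (0 : ℝ), |u| < δ :=
      (show Continuous fun u : ℝ => |u| by fun_prop).continuousAt.eventually_lt_const
        (by simpa using hδ)
    obtain ⟨R, hR, hb⟩ := Metric.nhds_basis_closedBall.eventually_iff.1 (h1.and (h2.and h3))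
    refine ⟨R, hR, fun u hu => hb ?_⟩
    rwa [Metric.mem_closedBall, Real.dist_eq, sub_zero]
  -- The parameter changes are deformed linearly to the translations `s + u` and `t + u`. Convexity
  -- keeps the parameters in the good neighbourhood.
  have hconv : ∀ σ ∈ Set.Icc (0 : ℝ) 1, ∀ (x u v : ℝ), |v - x| < δ → |u| < δ →
      |((1 - σ) * v + σ * (x + u)) - x| < δ := by
    intro σ hσ x u v hv hu
    rw [abs_lt] at *
    rcases hσ.1.eq_or_lt with h0 | h0
    · rw [← h0]
      constructor <;> linarith
    · constructor <;> nlinarith [mul_nonneg (sub_nonneg.2 hσ.2) (sub_pos.2 hv.2).le,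
        mul_nonneg (sub_nonneg.2 hσ.2) (sub_pos.2 hv.1).le, mul_pos h0 (sub_pos.2 hu.1),
        mul_pos h0 (sub_pos.2 hu.2)]
  -- Each intermediate parameter change is strictly increasing, so the crossing is met only at `u =
  -- 0` throughout the deformation.
  have hmono : ∀ σ ∈ Set.Icc (0 : ℝ) 1, ∀ (x : ℝ) (m : ℝ → ℝ), StrictMono m →
      StrictMono fun u => (1 - σ) * m u + σ * (x + u) := by
    intro σ hσ x m hm u v huv
    have := hm huv
    simp only
    rcases hσ.1.eq_or_lt with h0 | h0
    · rw [← h0]; linarith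
    · nlinarith [hσ.2]
  have key := hasIndex_crossMap_of_homotopy (S := Set.Icc (0 : ℝ) 1) isPreconnected_Icc
    (x := curve f s) (a := fun σ u => curve f ((1 - σ) * k u + σ * (s + u)))
    (b := fun σ u => curve f ((1 - σ) * l u + σ * (t + u))) (n := n) (q := 0) (q' := 1)
    (hc.comp (f := fun y : ℝ × ℝ => (1 - y.1) * k y.2 + y.1 * (s + y.2)) (by fun_prop))
    (hc.comp (f := fun y : ℝ × ℝ => (1 - y.1) * l y.2 + y.1 * (t + y.2)) (by fun_prop))
    hR ?_ ?_ (by simp) (by simp) (by simpa using hn)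
  · simpa using key
  · intro σ hσ u hu
    obtain ⟨h1, h2, h3⟩ := hkl u hu
    exact (hball (_, _) (hconv σ hσ s u _ h1 h3) (hconv σ hσ t u _ h2 h3)).2
  · intro σ hσ w hw hw0
    rw [mem_closedBall_zero_iff, Prod.norm_def, max_le_iff] at hw
    obtain ⟨h1, -, h3⟩ := hkl w.1 hw.1
    obtain ⟨-, h5, h6⟩ := hkl w.2 hw.2
    refine (hball (_, _) (hconv σ hσ s _ _ h1 h3) (hconv σ hσ t _ _ h5 h6)).1 fun e => hw0 ?_
    rw [Prod.mk.injEq] at e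
    have e1 := (hmono σ hσ s k hk).injective (a₁ := w.1) (a₂ := 0)
      (e.1.trans (by simp only [hks]; ring))
    have e2 := (hmono σ hσ t l hl).injective (a₁ := w.2) (a₂ := 0)
      (e.2.trans (by simp only [hlt]; ring))
    exact Prod.ext e1 e2

/-- The sign of a crossing is invariant under isotopy and reparametrization. -/
theorem crossSign_eq_of_isotopy [OrientedSurface M] {f f' : UnitAddCircle → M}
    (hf : IsGenericLoop f) (hf' : IsGenericLoop f') {h : unitInterval → M ≃ₜ M}
    (hc : Continuous fun q : unitInterval × M => h q.1 q.2) (h0 : h 0 = Homeomorph.refl M)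
    (g : ℝ ≃o ℝ) (hg : ∀ t, curve f' t = h 1 (curve f (g t))) {s t : ℝ}
    (hst : (s : UnitAddCircle) ≠ t) (hst' : (g s : UnitAddCircle) ≠ g t)
    (h' : curve f' s = curve f' t) : crossSign f' s t = crossSign f (g s) (g t) := by
  have hfc := hf.continuous_curve
  have hcr : curve f (g s) = curve f (g t) := (h 1).injective (by rw [← hg, ← hg, h'])
  -- Extended to all times by constancy outside `[0, 1]`, the isotopy is parametrized by a connected
  -- line in which balls are convex.
  set H : ℝ → M ≃ₜ M := fun τ => h (Set.projIcc (0 : ℝ) 1 zero_le_one τ) with hH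
  have hHc : Continuous fun q : ℝ × M => H q.1 q.2 :=
    hc.comp (((continuous_projIcc (h := zero_le_one (α := ℝ))).comp continuous_fst).prodMk
      continuous_snd)
  have hH0 : H 0 = Homeomorph.refl M := by
    rw [← h0]; simp only [hH, Set.projIcc_left]; rfl
  have hH1 : H 1 = h 1 := by simp only [hH, Set.projIcc_right]; rfl
  set p := curve f (g s) with hp
  set a : ℝ → ℝ → M := fun τ u => H τ (curve f (g s + u)) with ha
  set b : ℝ → ℝ → M := fun τ u => H τ (curve f (g t + u)) with hb
  have hac : Continuous (Function.uncurry a) :=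
    hHc.comp (f := fun y : ℝ × ℝ => (y.1, curve f (g s + y.2))) (by fun_prop)
  have hbc : Continuous (Function.uncurry b) :=
    hHc.comp (f := fun y : ℝ × ℝ => (y.1, curve f (g t + y.2))) (by fun_prop)
  have hac' : ∀ τ, Continuous (a τ) := fun τ => hac.comp (Continuous.prodMk_right τ)
  have hbc' : ∀ τ, Continuous (b τ) := fun τ => hbc.comp (Continuous.prodMk_right τ)
  have ha0 : ∀ τ, a τ 0 = H τ p := fun τ => by simp only [ha, add_zero, hp]
  have hb0 : ∀ τ, b τ 0 = H τ p := fun τ => by simp only [hb, add_zero, hcr]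
  have hne : ∀ᶠ w in 𝓝 (0 : ℝ × ℝ), w ≠ 0 → curve f (g s + w.1) ≠ curve f (g t + w.2) := by
    have h1 : Tendsto (fun w : ℝ × ℝ => (g s, g t) + w) (𝓝 0) (𝓝 (g s, g t)) := by
      have : Continuous fun w : ℝ × ℝ => (g s, g t) + w := by fun_prop
      simpa using this.tendsto 0
    filter_upwards [h1.eventually (hf.eventually_ne hst' hcr)] with w hw hw0
    exact hw (by simpa using hw0)
  have hne' : ∀ τ, ∀ᶠ w in 𝓝 (0 : ℝ × ℝ), w ≠ 0 → a τ w.1 ≠ b τ w.2 := by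
    intro τ
    filter_upwards [hne] with w hw hw0 e
    exact hw hw0 ((H τ).injective e)
  set n := -crossSign f (g s) (g t) with hn
  -- The chart is centred at the moving crossing. Near `τ₀` one passes to the chart fixed at time
  -- `τ₀`, deforms there, and passes back by `HasIndex.chart_change`.
  have hloc : IsLocallyConstant fun τ => HasIndex (crossMap (H τ p) (a τ) (b τ)) n := by
    rw [IsLocallyConstant.iff_eventually_eq]
    intro τ₀
    have hU := (chartAt (EuclideanHalfSpace 2) (H τ₀ p)).open_source
    have hps := mem_chart_source (EuclideanHalfSpace 2) (H τ₀ p)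
    have h1 : ∀ᶠ y : ℝ × ℝ in 𝓝 (τ₀, 0),
        a y.1 y.2 ∈ (chartAt (EuclideanHalfSpace 2) (H τ₀ p)).source :=
      hac.continuousAt.eventually (hU.mem_nhds (by
        change a τ₀ 0 ∈ _; rw [ha0]; exact hps))
    have h2 : ∀ᶠ y : ℝ × ℝ in 𝓝 (τ₀, 0),
        b y.1 y.2 ∈ (chartAt (EuclideanHalfSpace 2) (H τ₀ p)).source :=
      hbc.continuousAt.eventually (hU.mem_nhds (by
        change b τ₀ 0 ∈ _; rw [hb0]; exact hps))
    obtain ⟨R₁, hR₁, hb₁⟩ := Metric.nhds_basis_closedBall.eventually_iff.1 (h1.and h2)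
    obtain ⟨R₂, hR₂, hb₂⟩ := Metric.nhds_basis_closedBall.eventually_iff.1 hne
    set R := min R₁ R₂ with hRdef
    have hR : 0 < R := lt_min hR₁ hR₂
    have hsrc : ∀ τ ∈ Metric.ball τ₀ R, ∀ u, |u| ≤ R →
        a τ u ∈ (chartAt (EuclideanHalfSpace 2) (H τ₀ p)).source ∧
        b τ u ∈ (chartAt (EuclideanHalfSpace 2) (H τ₀ p)).source := by
      intro τ hτ u hu
      refine hb₁ (x := (τ, u)) ?_
      rw [Metric.mem_closedBall, Prod.dist_eq, max_le_iff]
      refine ⟨(Metric.mem_ball.1 hτ).le.trans (min_le_left _ _), ?_⟩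
      simpa using hu.trans (min_le_left _ _)
    have hiso : ∀ τ ∈ Metric.ball τ₀ R, ∀ w ∈ Metric.closedBall (0 : ℝ × ℝ) R, w ≠ 0 →
        a τ w.1 ≠ b τ w.2 := by
      intro τ _ w hw hw0 e
      exact hb₂ (Metric.closedBall_subset_closedBall (min_le_right _ _) hw) hw0
        ((H τ).injective e)
    have hhom : ∀ τ ∈ Metric.ball τ₀ R, ∀ τ' ∈ Metric.ball τ₀ R,
        HasIndex (crossMap (H τ₀ p) (a τ) (b τ)) n →
        HasIndex (crossMap (H τ₀ p) (a τ') (b τ')) n := fun τ hτ τ' hτ' =>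
      hasIndex_crossMap_of_homotopy (convex_ball τ₀ R).isPreconnected hac hbc hR hsrc hiso hτ hτ'
    have hτ₀ : τ₀ ∈ Metric.ball τ₀ R := Metric.mem_ball_self hR
    filter_upwards [Metric.ball_mem_nhds τ₀ hR] with τ hτ
    have hm1 : a τ 0 ∈ (chartAt (EuclideanHalfSpace 2) (H τ₀ p)).source :=
      (hsrc τ hτ 0 (by simpa using hR.le)).1
    have hm2 : a τ 0 ∈ (chartAt (EuclideanHalfSpace 2) (H τ p)).source := by
      rw [ha0]; exact mem_chart_source _ _
    have hab : a τ 0 = b τ 0 := (ha0 τ).trans (hb0 τ).symm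
    refine propext ⟨fun hi => hhom τ hτ τ₀ hτ₀ ?_, fun hi => ?_⟩
    · exact hi.chart_change (hac' τ) (hbc' τ) hab hm2 hm1 (hne' τ)
    · exact (hhom τ₀ hτ₀ τ hτ hi).chart_change (hac' τ) (hbc' τ) hab hm1 hm2 (hne' τ)
  have hstart : HasIndex (crossMap (H 0 p) (a 0) (b 0)) n := by
    have := hf.hasIndex hst' hcr
    simpa only [ha, hb, hH0, Homeomorph.refl_apply, id_eq] using this
  have hend := (hloc.apply_eq_of_preconnectedSpace 0 1).mp hstart
  -- At time `1` the branches are those of `f'`, with parameters changed by the increasing map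
  -- `g.symm`.
  have e1 : ∀ y, H 1 (curve f y) = curve f' (g.symm y) := fun y => by
    rw [hg, hH1, OrderIso.apply_symm_apply]
  simp only [ha, hb, hp, e1, OrderIso.symm_apply_apply] at hend
  have hgc : Continuous g.symm := g.symm.continuous
  have := hf'.hasIndex_reparam hst h' (k := fun u => g.symm (g s + u))
    (l := fun u => g.symm (g t + u)) (fun u v huv => g.symm.strictMono (by simpa using huv))
    (fun u v huv => g.symm.strictMono (by simpa using huv)) (by fun_prop) (by fun_prop)
    (by simp) (by simp) hend
  omega

end Loops

end SurfaceLoops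

namespace SurfaceLoops

open Filter Topology

/-! ### Loops running along parts of a loop -/

theorem map_add_int_of_map_add_one {S : ℝ → ℝ} (h : ∀ u, S (u + 1) = S u + 1) (u : ℝ) (n : ℤ) :
    S (u + n) = S u + n := by
  induction n using Int.induction_on with
  | zero => simp
  | succ k ih => push_cast at *; rw [← add_assoc, h, ih, add_assoc]
  | pred k ih =>
    have := h (u + (-k - 1))
    rw [show u + (-k - 1) + 1 = u + -(k : ℝ) by ring] at this
    push_cast at *
    linarith

/-- The periodic subset of `ℝ` lying over the arc from `a` to `b`. -/
def arcSet (a b : ℝ) : Set ℝ := {x | ∃ n : ℤ, a + n ≤ x ∧ x < b + n}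

theorem arcSet_add_int (a b : ℝ) (n : ℤ) : arcSet (a + n) (b + n) = arcSet a b := by
  ext x
  constructor
  · rintro ⟨m, h1, h2⟩
    exact ⟨n + m, by push_cast; linarith, by push_cast; linarith⟩
  · rintro ⟨m, h1, h2⟩
    exact ⟨m - n, by push_cast; linarith, by push_cast; linarith⟩

theorem add_int_mem_arcSet {a b x : ℝ} (n : ℤ) : x + n ∈ arcSet a b ↔ x ∈ arcSet a b := by
  constructor
  · rintro ⟨m, h1, h2⟩
    exact ⟨m - n, by push_cast; linarith, by push_cast; linarith⟩
  · rintro ⟨m, h1, h2⟩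
    exact ⟨m + n, by push_cast; linarith, by push_cast; linarith⟩

theorem compl_arcSet (a b : ℝ) :
    (arcSet a b)ᶜ = arcSet b (a + 1) := by
  ext x
  have h1 := Int.floor_le (x - a)
  have h2 := Int.lt_floor_add_one (x - a)
  constructor
  · intro hx
    refine ⟨⌊x - a⌋, ?_, by linarith⟩
    by_contra hlt
    exact hx ⟨⌊x - a⌋, by linarith, by linarith⟩
  · rintro ⟨n, h3, h4⟩ ⟨m, h5, h6⟩
    have h7 : (n : ℝ) < m := by linarith
    have h8 : (m : ℝ) < n + 1 := by linarith
    have h7' : n < m := by exact_mod_cast h7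
    have h8' : m < n + 1 := by exact_mod_cast h8
    omega

theorem mem_arcSet_iff {a b x c : ℝ} (ha : c ≤ a) (hb : b ≤ c + 1) (hx : c ≤ x) (hx' : x < c + 1) :
    x ∈ arcSet a b ↔ a ≤ x ∧ x < b := by
  constructor
  · rintro ⟨n, h1, h2⟩
    have h3 : (n : ℝ) < 1 := by linarith
    have h4 : (-1 : ℝ) < n := by linarith
    have h3' : n < 1 := by exact_mod_cast h3
    have h4' : -1 < n := by exact_mod_cast h4
    have : n = 0 := by omega
    subst this
    rw [Int.cast_zero, add_zero] at h1 h2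
    exact ⟨h1, h2⟩
  · rintro ⟨h1, h2⟩
    exact ⟨0, by simpa using h1, by simpa using h2⟩

/-- `S` may jump, so the image is only the part of the target arc that `S` reaches. -/
theorem image_arcSet {S : ℝ → ℝ} (hS : StrictMono S) (h1 : ∀ u, S (u + 1) = S u + 1) (a b : ℝ) :
    S '' arcSet a b = Set.range S ∩ arcSet (S a) (S b) := by
  ext x
  constructor
  · rintro ⟨u, ⟨n, h2, h3⟩, rfl⟩
    refine ⟨Set.mem_range_self u, n, ?_, ?_⟩
    · rw [← map_add_int_of_map_add_one h1]
      exact hS.monotone h2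
    · rw [← map_add_int_of_map_add_one h1]
      exact hS h3
  · rintro ⟨⟨u, rfl⟩, n, h2, h3⟩
    rw [← map_add_int_of_map_add_one h1] at h2 h3
    exact ⟨u, ⟨n, hS.le_iff_le.1 h2, hS.lt_iff_lt.1 h3⟩, rfl⟩

/-- The parametrization of `arcSet a b` underlying `arcMap`. -/
noncomputable def arcLift (a b u : ℝ) : ℝ := a + (b - a) * Int.fract u + ⌊u⌋

theorem arcLift_eq_aff (a b u : ℝ) : arcLift a b u = aff a b ⌊u⌋ u + ⌊u⌋ := rfl

theorem arcLift_add_one (a b u : ℝ) : arcLift a b (u + 1) = arcLift a b u + 1 := by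
  simp only [arcLift, Int.fract_add_one, Int.floor_add_one]
  push_cast
  ring

theorem arcLift_bounds {a b : ℝ} (hab : a < b) (u : ℝ) :
    a + ⌊u⌋ ≤ arcLift a b u ∧ arcLift a b u < b + ⌊u⌋ := by
  have h1 := Int.fract_nonneg u
  have h2 := Int.fract_lt_one u
  constructor <;> rw [arcLift] <;> nlinarith

theorem arcLift_strictMono {a b : ℝ} (hab : a < b) (hb : b ≤ a + 1) : StrictMono (arcLift a b) := by
  intro u v huv
  rcases (Int.floor_mono huv.le).eq_or_lt with h | h
  · have : Int.fract u < Int.fract v := by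
      rw [Int.fract, Int.fract, h]
      linarith
    rw [arcLift, arcLift, h]
    nlinarith
  · have h1 : (⌊u⌋ : ℝ) + 1 ≤ ⌊v⌋ := by exact_mod_cast h
    linarith [(arcLift_bounds hab u).2, (arcLift_bounds hab v).1]

theorem range_arcLift {a b : ℝ} (hab : a < b) : Set.range (arcLift a b) = arcSet a b := by
  ext x
  constructor
  · rintro ⟨u, rfl⟩
    exact ⟨⌊u⌋, arcLift_bounds hab u⟩
  · rintro ⟨n, h1, h2⟩
    have hk : 0 < b - a := sub_pos.2 hab
    have h3 : (x - a - n) / (b - a) ∈ Set.Ico (0 : ℝ) 1 :=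
      ⟨div_nonneg (by linarith) hk.le, (div_lt_one hk).2 (by linarith)⟩
    refine ⟨(x - a - n) / (b - a) + n, ?_⟩
    rw [arcLift, Int.fract_add_intCast, Int.fract_eq_self.2 h3, Int.floor_add_intCast,
      Int.floor_eq_zero_iff.2 h3, mul_div_cancel₀ _ hk.ne']
    push_cast
    ring

theorem curve_arcMap_eq {M : Type*} (f : UnitAddCircle → M) (a b u : ℝ) :
    curve (arcMap f a b) u = curve f (arcLift a b u) := by
  rw [arcLift, curve_add_int, curve_arcMap]

/-- `g` increases by a positive integer over a unit step, and so does its inverse; both integers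
being at least one, the step of `g` is exactly one. -/
theorem map_add_one_of_lift {φ : UnitAddCircle ≃ₜ UnitAddCircle} {g : ℝ ≃o ℝ}
    (h : ∀ t : ℝ, φ t = (g t : UnitAddCircle)) (t : ℝ) : g (t + 1) = g t + 1 := by
  have h1 : (g t : UnitAddCircle) = g (t + 1) := by
    rw [← h, ← h]
    exact congrArg φ ((coe_eq_coe_iff _ _).2 ⟨1, by simp⟩)
  obtain ⟨n, hn⟩ := (coe_eq_coe_iff _ _).1 h1
  have h2 : (t : UnitAddCircle) = g.symm (g t + 1) := by
    apply φ.injective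
    rw [h, h, OrderIso.apply_symm_apply]
    exact (coe_eq_coe_iff _ _).2 ⟨1, by simp⟩
  obtain ⟨m, hm⟩ := (coe_eq_coe_iff _ _).1 h2
  have hn0 : (0 : ℝ) < n := by linarith [g.strictMono (lt_add_one t)]
  have hm0 : (0 : ℝ) < m := by
    have := g.symm.strictMono (lt_add_one (g t))
    rw [OrderIso.symm_apply_apply, hm] at this
    linarith
  have hn1 : (1 : ℝ) ≤ n := by exact_mod_cast (show (0 : ℤ) < n by exact_mod_cast hn0)
  have hm1 : (1 : ℝ) ≤ m := by exact_mod_cast (show (0 : ℤ) < m by exact_mod_cast hm0)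
  have h3 : g (t + 1) ≤ g t + 1 := by
    rw [← g.le_symm_apply, hm]
    linarith
  linarith

/-- An increasing bijection of `ℝ` commuting with the unit translation induces a homeomorphism of
the circle. -/
theorem exists_circle_homeomorph (g : ℝ ≃o ℝ) (hg : ∀ t, g (t + 1) = g t + 1) :
    ∃ φ : UnitAddCircle ≃ₜ UnitAddCircle, ∀ t : ℝ, φ t = (g t : UnitAddCircle) := by
  have hg' : ∀ t, g.symm (t + 1) = g.symm t + 1 := fun t => by
    rw [OrderIso.symm_apply_eq, hg, OrderIso.apply_symm_apply]
  have aux : ∀ k : ℝ ≃o ℝ, (∀ t, k (t + 1) = k t + 1) →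
      ∃ φ : UnitAddCircle → UnitAddCircle, Continuous φ ∧ ∀ t : ℝ, φ t = (k t : UnitAddCircle) := by
    intro k hk
    have hper : Function.Periodic (fun t : ℝ => (k t : UnitAddCircle)) 1 := fun t => by
      simp only [hk]
      exact ((coe_eq_coe_iff _ _).2 ⟨1, by simp⟩).symm
    refine ⟨hper.lift, ?_, fun t => rfl⟩
    refine (QuotientAddGroup.isQuotientMap_mk
      (N := AddSubgroup.zmultiples (1 : ℝ))).continuous_iff.2 ?_
    exact (AddCircle.continuous_mk' 1).comp k.continuous
  obtain ⟨φ, hφc, hφ⟩ := aux g hg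
  obtain ⟨ψ, hψc, hψ⟩ := aux g.symm hg'
  refine ⟨⟨⟨φ, ψ, fun x => ?_, fun x => ?_⟩, hφc, hψc⟩, hφ⟩
  · obtain ⟨t, -, -, rfl⟩ := exists_rep 0 x
    rw [hφ, hψ, OrderIso.symm_apply_apply]
  · obtain ⟨t, -, -, rfl⟩ := exists_rep 0 x
    rw [hψ, hφ, OrderIso.apply_symm_apply]

/-- The loop `A` runs once, in the positive direction, along the part of the loop `f` lying under
the periodic set `P` of parameters. -/
def Traverses {M : Type*} (f A : UnitAddCircle → M) (P : Set ℝ) : Prop :=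
  ∃ S : ℝ → ℝ, StrictMono S ∧ (∀ u, S (u + 1) = S u + 1) ∧ (∀ u, curve A u = curve f (S u)) ∧
    Set.range S = P

/-- Arcs of arcs: a loop cut out of `A` is located on `f` by composing the parametrizations. -/
theorem Traverses.trans {M : Type*} {f A B : UnitAddCircle → M} {S : ℝ → ℝ} {a b : ℝ}
    (hS : StrictMono S) (hS1 : ∀ u, S (u + 1) = S u + 1) (hA : ∀ u, curve A u = curve f (S u))
    (hB : Traverses A B (arcSet a b)) :
    Traverses f B (Set.range S ∩ arcSet (S a) (S b)) := by
  obtain ⟨T, hT, hT1, hTc, hTr⟩ := hB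
  refine ⟨S ∘ T, hS.comp hT, fun u => ?_, fun u => ?_, ?_⟩
  · rw [Function.comp_apply, hT1, hS1, Function.comp_apply]
  · rw [hTc, hA, Function.comp_apply]
  · rw [Set.range_comp, hTr, image_arcSet hS hS1]

theorem traverses_arcMap {M : Type*} (f : UnitAddCircle → M) {a b : ℝ} (hab : a < b)
    (hb : b ≤ a + 1) : Traverses f (arcMap f a b) (arcSet a b) :=
  ⟨arcLift a b, arcLift_strictMono hab hb, arcLift_add_one a b, curve_arcMap_eq f a b,
    range_arcLift hab⟩

/-! ### Isotopies and signs of loops cut out of a loop -/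

section Loops

variable {M : Type*} [TopologicalSpace M] [ChartedSpace (EuclideanHalfSpace 2) M]

/-- Two pointed loops running along the same part of a loop, up to an ambient isotopy, are
isotopic. -/
theorem isotopic_of_traverses {f f' : UnitAddCircle → M} {A B : PointedLoop M} {P : Set ℝ}
    (hA : Traverses f A.toFun P) (hB : Traverses f' B.toFun P) {h : unitInterval → M ≃ₜ M}
    (hc : Continuous fun q : unitInterval × M => h q.1 q.2) (h0 : h 0 = Homeomorph.refl M)
    (hf : ∀ t, curve f' t = h 1 (curve f t)) (hbase : B.base = h 1 A.base) : Isotopic A B := by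
  obtain ⟨S, hS, hS1, hSc, hSr⟩ := hA
  obtain ⟨T, hT, hT1, hTc, hTr⟩ := hB
  -- `S` and `T` may be discontinuous where the arcs are closed up, but they have the same range, so
  -- `S⁻¹ ∘ T` is an increasing bijection of `ℝ`, hence a homeomorphism.
  set g : ℝ ≃o ℝ := ((hT.orderIso T).trans
    (OrderIso.setCongr _ _ (hTr.trans hSr.symm))).trans (hS.orderIso S).symm with hg
  have hSg : ∀ u, S (g u) = T u := fun u => by
    have h1 : (hS.orderIso S) (g u) = ⟨T u, by rw [hSr, ← hTr]; exact ⟨u, rfl⟩⟩ := by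
      rw [hg, OrderIso.trans_apply, OrderIso.apply_symm_apply]
      rfl
    exact congrArg Subtype.val h1
  have hg1 : ∀ u, g (u + 1) = g u + 1 := fun u => hS.injective (by rw [hS1, hSg, hSg, hT1])
  obtain ⟨φ, hφ⟩ := exists_circle_homeomorph g hg1
  refine ⟨h, φ, hc, h0, ⟨g, hφ⟩, fun x => ?_, hbase⟩
  obtain ⟨t, -, -, rfl⟩ := exists_rep 0 x
  rw [hφ]
  change curve B.toFun t = h 1 (curve A.toFun (g t))
  rw [hTc, hSc, hSg, hf]

theorem isotopic_of_traverses_same {f : UnitAddCircle → M} {A B : PointedLoop M} {P : Set ℝ}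
    (hA : Traverses f A.toFun P) (hB : Traverses f B.toFun P) (hbase : B.base = A.base) :
    Isotopic A B :=
  isotopic_of_traverses hA hB (h := fun _ => Homeomorph.refl M) continuous_snd rfl (fun _ => rfl)
    hbase

theorem vel_add_int {f : UnitAddCircle → M} {t : ℝ} (h : SmoothAt (curve f) t) (n : ℤ) :
    SmoothAt (curve f) (t + n) ∧ vel (curve f) (t + n) = vel (curve f) t := by
  have haff : ∀ u, aff (-n) (-n + 1) 0 u = u - n := fun u => by
    simp only [aff, Int.cast_zero]; ring
  have h1 : curve f = curve f ∘ aff (-n) (-n + 1) 0 := by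
    funext u
    have := curve_add_int f u (-n)
    rw [Function.comp_apply, haff, ← this]
    push_cast
    rw [sub_eq_add_neg]
  have h2 := velWithin_of_aff (c := curve f) (d := curve f) (a := -n) (b := -n + 1) (n := 0)
    (u := t + n) (S := Set.univ) (T := Set.univ) (Set.mem_univ _) uniqueDiffWithinAt_univ
    (Set.mapsTo_univ _ _) (by rw [haff, add_sub_cancel_right]; exact h)
    (by rw [← h1])
  rw [haff, add_sub_cancel_right, add_sub_cancel_left, one_smul] at h2
  rw [vel_eq_velWithin, vel_eq_velWithin]
  exact h2

theorem crossSign_add_int {f : UnitAddCircle → M} {s t : ℝ} (hs : SmoothAt (curve f) s)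
    (ht : SmoothAt (curve f) t) (n m : ℤ) : crossSign f (s + n) (t + m) = crossSign f s t := by
  rw [crossSign, crossSign, (vel_add_int hs n).2, (vel_add_int ht m).2]

/-- Away from the corner, restricting to an arc multiplies both velocities by `b - a`, hence the
determinant by a positive square. -/
theorem crossSign_arcMap {f : UnitAddCircle → M} {a b u v : ℝ} (hab : a < b)
    (hu : (⌊u⌋ : ℝ) ≠ u) (hv : (⌊v⌋ : ℝ) ≠ v) (hsu : SmoothAt (curve f) (arcLift a b u))
    (hsv : SmoothAt (curve f) (arcLift a b v)) :
    crossSign (arcMap f a b) u v = crossSign f (arcLift a b u) (arcLift a b v) := by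
  have key : ∀ x, (⌊x⌋ : ℝ) ≠ x → SmoothAt (curve f) (arcLift a b x) →
      vel (curve (arcMap f a b)) x = (b - a) • vel (curve f) (arcLift a b x) := by
    intro x hx hs
    have h1 := vel_add_int hs (-⌊x⌋)
    rw [show arcLift a b x + (-⌊x⌋ : ℤ) = aff a b ⌊x⌋ x by
      rw [arcLift_eq_aff]; push_cast; ring] at h1
    rw [(smoothAt_arcMap hx h1.1).2, h1.2]
  rw [crossSign, crossSign, key u hu hsu, key v hv hsv]
  have hk : 0 < (b - a) * (b - a) := mul_pos (sub_pos.2 hab) (sub_pos.2 hab)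
  have e : ∀ A B : EuclideanSpace ℝ (Fin 2), ((b - a) • A) 0 * ((b - a) • B) 1 -
      ((b - a) • A) 1 * ((b - a) • B) 0 = (b - a) * (b - a) * (A 0 * B 1 - A 1 * B 0) := by
    intro A B
    simp only [PiLp.smul_apply, smul_eq_mul]
    ring
  simp only [e, mul_pos_iff_of_pos_left hk]

/-! ### Crossings, arcs and signs of subloops -/

namespace PointedLoop

variable (α : PointedLoop M)

theorem exists_eq_baseParam_add {t : ℝ} (h : curve α.toFun t = α.base) :
    ∃ n : ℤ, t = α.baseParam + n := by
  rw [← coe_eq_coe_iff]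
  by_contra hne
  exact α.base_not_mem ⟨_, _, hne, α.curve_baseParam, h⟩

/-- The parameters of a crossing are determined by their order after the base point. -/
theorem params_unique {b s t : ℝ} (hb : curve α.toFun b = α.base) (hs : b < s) (hst : s < t)
    (ht : t < b + 1) (p : crossings α.toFun) (hps : curve α.toFun s = p)
    (hpt : curve α.toFun t = p) : ∃ n : ℤ, s = α.param₁ p + n ∧ t = α.param₂ p + n := by
  obtain ⟨n, rfl⟩ := α.exists_eq_baseParam_add hb
  obtain ⟨h1, h2, h3, h4, h5⟩ := α.params_spec p
  -- Crossings are double, so within one period after the base point there are no parameters of `p`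
  -- but the two chosen ones; the order then tells them apart.
  have key : ∀ x : ℝ, α.baseParam + n < x → x < α.baseParam + n + 1 → curve α.toFun x = p →
      x = α.param₁ p + n ∨ x = α.param₂ p + n := by
    intro x hx hx' hxp
    have hxn : curve α.toFun (x - n) = p := by
      rw [← hxp]
      have := curve_add_int α.toFun x (-n)
      push_cast at this
      rwa [← sub_eq_add_neg] at this
    rcases α.generic.double ((x - n : ℝ) : UnitAddCircle) (α.param₁ p) (α.param₂ p)
      (hxn.trans h4.symm) (h4.trans h5.symm) with e | e | e
    · left
      have := eq_of_coe_eq (a := α.baseParam) (by linarith) (by linarith) h1.le (by linarith) e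
      linarith
    · have := eq_of_coe_eq (a := α.baseParam) h1.le (by linarith) (by linarith) h3 e
      linarith
    · right
      have := eq_of_coe_eq (a := α.baseParam) (by linarith) (by linarith) (by linarith) h3 e
      linarith
  refine ⟨n, ?_⟩
  rcases key s hs (by linarith) hps with e1 | e1 <;>
    rcases key t (by linarith) ht hpt with e2 | e2
  · linarith
  · exact ⟨e1, e2⟩
  · linarith
  · linarith

theorem coe_param_ne (p : crossings α.toFun) :
    (α.param₁ p : UnitAddCircle) ≠ α.param₂ p := by
  obtain ⟨h1, h2, h3, h4, h5⟩ := α.params_spec p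
  exact fun e => h2.ne (eq_of_coe_eq (a := α.baseParam) h1.le (by linarith) (by linarith) h3 e)

theorem smoothAt_params (p : crossings α.toFun) :
    SmoothAt (curve α.toFun) (α.param₁ p) ∧ SmoothAt (curve α.toFun) (α.param₂ p) := by
  obtain ⟨h1, h2, h3, h4, h5⟩ := α.params_spec p
  exact α.generic.crossing_smooth _ _ (α.coe_param_ne p) (h4.trans h5.symm)

/-- The set of parameters of the arc from `p₁` to `p₂`. -/
def arc (p : crossings α.toFun) : Set ℝ := arcSet (α.param₁ p) (α.param₂ p)

theorem compl_arc (p : crossings α.toFun) :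
    (α.arc p)ᶜ = arcSet (α.param₂ p) (α.param₁ p + 1) := by
  exact compl_arcSet _ _

theorem traverses_inner (p : crossings α.toFun) :
    Traverses α.toFun (α.inner p).toFun (α.arc p) := by
  obtain ⟨h1, h2, h3, -, -⟩ := α.params_spec p
  exact traverses_arcMap _ h2 (by linarith)

theorem traverses_outer (p : crossings α.toFun) :
    Traverses α.toFun (α.outer p).toFun (α.arc p)ᶜ := by
  obtain ⟨h1, h2, h3, -, -⟩ := α.params_spec p
  rw [compl_arc]
  exact traverses_arcMap _ (by linarith) (by linarith)

variable {α}

/-- The pointed loop `A` runs along a part of `α`, parametrized by `S`, in such a way that the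
crossings of `A` are met in the same order as on `α`. -/
structure IsSubloop (α A : PointedLoop M) (S : ℝ → ℝ) : Prop where
  strictMono : StrictMono S
  map_add_one : ∀ u, S (u + 1) = S u + 1
  curve_eq : ∀ u, curve A.toFun u = curve α.toFun (S u)
  window : ∃ n : ℤ, α.baseParam + n ≤ S A.baseParam ∧
    ∀ u < A.baseParam + 1, S u < α.baseParam + n + 1

/-- The base point sits at the integer parameters, where the arc starts at `p₁`; the arc ends at
`p₂` before `α` returns to its base point. -/
theorem isSubloop_inner (p : crossings α.toFun) :
    IsSubloop α (α.inner p) (arcLift (α.param₁ p) (α.param₂ p)) := by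
  obtain ⟨h1, h2, h3, h4, h5⟩ := α.params_spec p
  refine ⟨arcLift_strictMono h2 (by linarith), arcLift_add_one _ _, curve_arcMap_eq _ _ _, ?_⟩
  have h0 : curve (α.inner p).toFun 0 = (α.inner p).base := by
    change curve (arcMap _ _ _) 0 = _
    rw [curve_arcMap, Int.fract_zero, mul_zero, add_zero, h4]
    rfl
  obtain ⟨n, hn⟩ := (α.inner p).exists_eq_baseParam_add h0
  have hb : (α.inner p).baseParam = (-n : ℤ) := by push_cast; linarith
  refine ⟨-n, ?_, fun u hu => ?_⟩
  · have := (arcLift_bounds h2 (α.inner p).baseParam).1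
    rw [hb, Int.floor_intCast] at this
    rw [hb]
    linarith
  · have h6 : ⌊u⌋ ≤ -n := by
      rw [← Int.lt_add_one_iff, Int.floor_lt]
      rw [hb] at hu
      exact_mod_cast hu
    have h7 : (⌊u⌋ : ℝ) ≤ (-n : ℤ) := by exact_mod_cast h6
    linarith [(arcLift_bounds h2 u).2]

/-- The base point is shared with `α`, so a period after it on the loop maps into a period after it
on `α`. -/
theorem isSubloop_outer (p : crossings α.toFun) :
    IsSubloop α (α.outer p) (arcLift (α.param₂ p) (α.param₁ p + 1)) := by
  obtain ⟨h1, h2, h3, h4, h5⟩ := α.params_spec p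
  have hm : StrictMono (arcLift (α.param₂ p) (α.param₁ p + 1)) :=
    arcLift_strictMono (by linarith) (by linarith)
  have hc : ∀ u, curve (α.outer p).toFun u =
      curve α.toFun (arcLift (α.param₂ p) (α.param₁ p + 1) u) :=
    curve_arcMap_eq _ _ _
  refine ⟨hm, arcLift_add_one _ _, hc, ?_⟩
  obtain ⟨n, hn⟩ := α.exists_eq_baseParam_add
    ((hc _).symm.trans (α.outer p).curve_baseParam)
  refine ⟨n, hn.ge, fun u hu => ?_⟩
  rw [← hn, ← arcLift_add_one]
  exact hm hu

namespace IsSubloop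

variable {A : PointedLoop M} {S : ℝ → ℝ}

/-- The window puts both images under `S` in one period of `α`, in the right order, so
`params_unique` identifies them with a common shift. -/
theorem params (hA : IsSubloop α A S) (q : crossings A.toFun) :
    ∃ (hq : q.1 ∈ crossings α.toFun) (n : ℤ),
      S (A.param₁ q) = α.param₁ ⟨q, hq⟩ + n ∧ S (A.param₂ q) = α.param₂ ⟨q, hq⟩ + n := by
  obtain ⟨h1, h2, h3, h4, h5⟩ := A.params_spec q
  obtain ⟨n, hn1, hn2⟩ := hA.window
  have e1 : curve α.toFun (S (A.param₁ q)) = q := by rw [← hA.curve_eq, h4]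
  have e2 : curve α.toFun (S (A.param₂ q)) = q := by rw [← hA.curve_eq, h5]
  have l1 := hA.strictMono h1
  have l2 := hA.strictMono h2
  have l3 := hn2 _ h3
  have hq : q.1 ∈ crossings α.toFun := ⟨_, _, fun e => l2.ne
    (eq_of_coe_eq (a := α.baseParam + n) (by linarith) (by linarith) (by linarith) l3 e), e1, e2⟩
  refine ⟨hq, α.params_unique (b := α.baseParam + n) ?_ (by linarith) l2 l3 ⟨q, hq⟩ e1 e2⟩
  rw [curve_add_int, curve_baseParam]

theorem mem_crossings_iff (hA : IsSubloop α A S) {q : M} : q ∈ crossings A.toFun ↔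
    ∃ hq : q ∈ crossings α.toFun,
      α.param₁ ⟨q, hq⟩ ∈ Set.range S ∧ α.param₂ ⟨q, hq⟩ ∈ Set.range S := by
  constructor
  · intro h
    obtain ⟨hq, n, e1, e2⟩ := hA.params ⟨q, h⟩
    refine ⟨hq, ⟨A.param₁ ⟨q, h⟩ + (-n : ℤ), ?_⟩, ⟨A.param₂ ⟨q, h⟩ + (-n : ℤ), ?_⟩⟩
    · rw [map_add_int_of_map_add_one hA.map_add_one, e1]; push_cast; ring
    · rw [map_add_int_of_map_add_one hA.map_add_one, e2]; push_cast; ring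
  · rintro ⟨hq, ⟨u, hu⟩, ⟨v, hv⟩⟩
    obtain ⟨-, -, -, h4, h5⟩ := α.params_spec ⟨q, hq⟩
    refine ⟨u, v, fun e => α.coe_param_ne ⟨q, hq⟩ ?_, ?_, ?_⟩
    · obtain ⟨n, rfl⟩ := (coe_eq_coe_iff _ _).1 e
      rw [map_add_int_of_map_add_one hA.map_add_one, hu] at hv
      exact (coe_eq_coe_iff _ _).2 ⟨n, hv.symm⟩
    · change curve A.toFun u = q
      rw [hA.curve_eq, hu, h4]
    · change curve A.toFun v = q
      rw [hA.curve_eq, hv, h5]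

theorem traverses_inner (hA : IsSubloop α A S) {q : M} (hq : q ∈ crossings A.toFun)
    (hq' : q ∈ crossings α.toFun) :
    Traverses α.toFun (A.inner ⟨q, hq⟩).toFun (Set.range S ∩ α.arc ⟨q, hq'⟩) := by
  obtain ⟨_, n, e1, e2⟩ := hA.params ⟨q, hq⟩
  have := Traverses.trans hA.strictMono hA.map_add_one hA.curve_eq (A.traverses_inner ⟨q, hq⟩)
  rwa [e1, e2, arcSet_add_int] at this

theorem traverses_outer (hA : IsSubloop α A S) {q : M} (hq : q ∈ crossings A.toFun)
    (hq' : q ∈ crossings α.toFun) :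
    Traverses α.toFun (A.outer ⟨q, hq⟩).toFun (Set.range S ∩ (α.arc ⟨q, hq'⟩)ᶜ) := by
  obtain ⟨_, n, e1, e2⟩ := hA.params ⟨q, hq⟩
  have h := A.traverses_outer ⟨q, hq⟩
  rw [compl_arc] at h
  have := Traverses.trans hA.strictMono hA.map_add_one hA.curve_eq h
  rw [hA.map_add_one, e1, e2, add_right_comm, arcSet_add_int] at this
  rwa [compl_arc]

end IsSubloop

theorem range_inner (p : crossings α.toFun) :
    Set.range (arcLift (α.param₁ p) (α.param₂ p)) = α.arc p :=
  range_arcLift (α.params_spec p).2.1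

theorem range_outer (p : crossings α.toFun) :
    Set.range (arcLift (α.param₂ p) (α.param₁ p + 1)) = (α.arc p)ᶜ := by
  obtain ⟨h1, h2, h3, -, -⟩ := α.params_spec p
  rw [compl_arc, range_arcLift (by linarith)]

theorem mem_crossings_inner_iff (p q : crossings α.toFun) : q.1 ∈ crossings (α.inner p).toFun ↔
    α.param₁ q ∈ α.arc p ∧ α.param₂ q ∈ α.arc p := by
  rw [(isSubloop_inner p).mem_crossings_iff, range_inner]
  exact ⟨fun ⟨_, h⟩ => h, fun h => ⟨q.2, h⟩⟩

theorem mem_crossings_outer_iff (p q : crossings α.toFun) : q.1 ∈ crossings (α.outer p).toFun ↔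
    α.param₁ q ∉ α.arc p ∧ α.param₂ q ∉ α.arc p := by
  rw [(isSubloop_outer p).mem_crossings_iff, range_outer]
  exact ⟨fun ⟨_, h⟩ => h, fun h => ⟨q.2, h⟩⟩

theorem param_mem_arc_iff (p q : crossings α.toFun) :
    (α.param₁ q ∈ α.arc p ↔ α.param₁ p ≤ α.param₁ q ∧ α.param₁ q < α.param₂ p) ∧
    (α.param₂ q ∈ α.arc p ↔ α.param₁ p ≤ α.param₂ q ∧ α.param₂ q < α.param₂ p) := by
  obtain ⟨h1, h2, h3, -, -⟩ := α.params_spec p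
  obtain ⟨h4, h5, h6, -, -⟩ := α.params_spec q
  exact ⟨mem_arcSet_iff h1.le h3.le h4.le (by linarith),
    mem_arcSet_iff h1.le h3.le (by linarith) h6⟩

/-- Integer parameters are the corner of the arc, and `hne` excludes them; the velocities at `q` are
then those of `α` up to a positive factor. -/
theorem sign_of_isSubloop {A : PointedLoop M} {a b : ℝ} (hab : a < b)
    (hA : IsSubloop α A (arcLift a b)) (hAf : A.toFun = arcMap α.toFun a b) {q : M}
    (hq : q ∈ crossings A.toFun) (hq' : q ∈ crossings α.toFun) (hne : curve α.toFun a ≠ q) :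
    A.sign ⟨q, hq⟩ = α.sign ⟨q, hq'⟩ := by
  obtain ⟨_, n, e1, e2⟩ := hA.params ⟨q, hq⟩
  obtain ⟨-, -, -, h4, h5⟩ := A.params_spec ⟨q, hq⟩
  obtain ⟨s1, s2⟩ := α.smoothAt_params ⟨q, hq'⟩
  have key : ∀ u, curve A.toFun u = q → (⌊u⌋ : ℝ) ≠ u := by
    intro u hu e
    apply hne
    rw [← hu, hAf, curve_arcMap, ← e, Int.fract_intCast, mul_zero, add_zero]
  change crossSign A.toFun _ _ = crossSign α.toFun _ _
  rw [← crossSign_add_int s1 s2 n n, ← e1, ← e2]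
  refine (congrFun (congrFun (congrArg crossSign hAf) _) _).trans
    (crossSign_arcMap hab (key _ h4) (key _ h5) ?_ ?_)
  · rw [e1]; exact (vel_add_int s1 n).1
  · rw [e2]; exact (vel_add_int s2 n).1

theorem sign_inner (p q : crossings α.toFun) (hq : q.1 ∈ crossings (α.inner p).toFun) :
    (α.inner p).sign ⟨q, hq⟩ = α.sign q := by
  obtain ⟨h1, h2, h3, h4, h5⟩ := α.params_spec p
  refine sign_of_isSubloop h2 (isSubloop_inner p) rfl hq q.2 ?_
  rw [h4]
  exact fun e => (α.inner p).base_not_mem (by rw [← e] at hq; exact hq)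

theorem sign_outer (p q : crossings α.toFun) (hq : q.1 ∈ crossings (α.outer p).toFun) :
    (α.outer p).sign ⟨q, hq⟩ = α.sign q := by
  obtain ⟨h1, h2, h3, h4, h5⟩ := α.params_spec p
  refine sign_of_isSubloop (by linarith) (isSubloop_outer p) rfl hq q.2 ?_
  rw [h5]
  intro e
  obtain rfl : p = q := Subtype.ext e
  exact ((mem_crossings_outer_iff p p).1 hq).1 ((param_mem_arc_iff p p).1.2 ⟨le_rfl, h2⟩)

end PointedLoop

end Loops

end SurfaceLoops

namespace SurfaceLoops

/-! ### Pre-Lie coalgebras are Lie coalgebras -/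

section Coalgebra

variable {R A : Type*} [CommRing R] [AddCommGroup A] [Module R A]

/-- The sum of the cyclic permutations kills the differences of odd permutations. -/
theorem cyclic_comp_perm23_comp_tau :
    (LinearMap.id + tau R A + tau R A ∘ₗ tau R A) ∘ₗ (perm R A).lTensor A ∘ₗ tau R A =
      (LinearMap.id + tau R A + tau R A ∘ₗ tau R A) ∘ₗ perm12 R A := by
  ext x y z
  simp [tau, perm12, perm]
  abel

/-- The cyclic sum depends only on the parity of the permutation that precedes it, and both
permutations here are odd. -/
theorem cyclic_comp_perm23 :
    (LinearMap.id + tau R A + tau R A ∘ₗ tau R A) ∘ₗ (perm R A).lTensor A =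
      (LinearMap.id + tau R A + tau R A ∘ₗ tau R A) ∘ₗ perm12 R A := by
  ext x y z
  simp [tau, perm12, perm]
  abel

theorem cyclic_comp_tau :
    (LinearMap.id + tau R A + tau R A ∘ₗ tau R A) ∘ₗ tau R A =
      LinearMap.id + tau R A + tau R A ∘ₗ tau R A := by
  ext x y z
  simp [tau]
  abel

/-- Serves to rewrite the swapped half of `(id ⊗ ν) ν` in terms of `(ρ ⊗ id) ρ`. -/
theorem lTensor_comp_perm (ρ : A →ₗ[R] A ⊗[R] A) :
    ρ.lTensor A ∘ₗ perm R A =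
      tau R A ∘ₗ (TensorProduct.assoc R A A A).toLinearMap ∘ₗ ρ.rTensor A := by
  ext x y
  simp [tau, perm]

theorem perm_comp_perm : perm R A ∘ₗ perm R A = LinearMap.id := by
  ext x y
  simp [perm]

/-- Under the cyclic sum `C`, the four terms of `(id ⊗ ν) ν` become `C (B - D) - C P¹² (B - D)`,
where `D = (ρ ⊗ id) ρ` and `B = (id ⊗ ρ) ρ`; the pre-Lie identity makes this zero. -/
theorem IsPreLieComultiplication.isLieCobracket {ρ : A →ₗ[R] A ⊗[R] A}
    (h : IsPreLieComultiplication ρ) : IsLieCobracket (antisymmetrization ρ) := by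
  constructor
  · rw [antisymmetrization, LinearMap.comp_sub, ← LinearMap.comp_assoc, perm_comp_perm,
      LinearMap.id_comp, neg_sub]
  · set C := LinearMap.id + tau R A + tau R A ∘ₗ tau R A with hC
    set B := ρ.lTensor A ∘ₗ ρ with hB
    set D := (TensorProduct.assoc R A A A).toLinearMap ∘ₗ ρ.rTensor A ∘ₗ ρ with hD
    have h1 : (antisymmetrization ρ).lTensor A ∘ₗ antisymmetrization ρ =
        B - (perm R A).lTensor A ∘ₗ B - (tau R A ∘ₗ D - (perm R A).lTensor A ∘ₗ tau R A ∘ₗ D) := by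
      have h2 : ρ.lTensor A ∘ₗ perm R A ∘ₗ ρ = tau R A ∘ₗ D := by
        rw [← LinearMap.comp_assoc, lTensor_comp_perm]
        rfl
      rw [← h2, antisymmetrization, LinearMap.lTensor_sub, LinearMap.lTensor_comp]
      simp only [LinearMap.sub_comp, LinearMap.comp_sub, LinearMap.comp_assoc, hB]
    have h2 : C ∘ₗ (D - B) = C ∘ₗ perm12 R A ∘ₗ (D - B) := by
      have h3 : perm12 R A ∘ₗ (D - B) = D - B := by
        have : (LinearMap.id - perm12 R A) ∘ₗ (D - B) = 0 := h
        rw [LinearMap.sub_comp, LinearMap.id_comp, sub_eq_zero] at this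
        exact this.symm
      rw [h3]
    rw [h1]
    have e1 : C ∘ₗ (perm R A).lTensor A ∘ₗ B = C ∘ₗ perm12 R A ∘ₗ B := by
      rw [← LinearMap.comp_assoc, cyclic_comp_perm23, LinearMap.comp_assoc]
    have e2 : C ∘ₗ tau R A ∘ₗ D = C ∘ₗ D := by
      rw [← LinearMap.comp_assoc, cyclic_comp_tau]
    have e3 : C ∘ₗ (perm R A).lTensor A ∘ₗ tau R A ∘ₗ D = C ∘ₗ perm12 R A ∘ₗ D := by
      have := congrArg (· ∘ₗ D) (cyclic_comp_perm23_comp_tau (R := R) (A := A))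
      simpa only [LinearMap.comp_assoc] using this
    simp only [LinearMap.comp_sub] at h2 ⊢
    rw [e1, e2, e3, ← sub_eq_zero.2 h2.symm]
    abel

end Coalgebra

section Loops

variable {M : Type*} [TopologicalSpace M] [ChartedSpace (EuclideanHalfSpace 2) M]

/-! ### The comultiplication on loops -/

/-- The value of the comultiplication on a pointed loop. -/
noncomputable def loopCoproduct (R : Type*) [CommRing R] (α : PointedLoop M) :
    LoopModule R M ⊗[R] LoopModule R M :=
  ∑ᶠ p : crossings α.toFun, α.sign p • ((α.inner p).gen R ⊗ₜ[R] (α.outer p).gen R)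

theorem gen_eq_of_isotopic (R : Type*) [CommRing R] {α β : PointedLoop M} (h : Isotopic α β) :
    α.gen R = β.gen R := by
  have : Quotient.mk (isotopySetoid M) α = Quotient.mk (isotopySetoid M) β := Quotient.sound h
  unfold PointedLoop.gen
  rw [this]

/-- An isotopy maps the crossings to crossings, with the same signs and isotopic loops at them. -/
theorem Isotopic.exists_crossings_bijective [OrientedSurface M] {α β : PointedLoop M}
    (hαβ : Isotopic α β) : ∃ e : crossings α.toFun → crossings β.toFun, Function.Bijective e ∧
      ∀ p, β.sign (e p) = α.sign p ∧ Isotopic (α.inner p) (β.inner (e p)) ∧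
        Isotopic (α.outer p) (β.outer (e p)) := by
  obtain ⟨h, φ, hc, h0, ⟨g, hg⟩, hα, hb⟩ := hαβ
  have hg1 := map_add_one_of_lift hg
  have hcurve : ∀ t, curve β.toFun t = h 1 (curve α.toFun (g t)) := fun t => by
    rw [curve, hα, hg]
    rfl
  have hmem : ∀ p, h 1 p ∈ crossings β.toFun ↔ p ∈ crossings α.toFun := by
    intro p
    constructor
    · rintro ⟨x, y, hxy, hx, hy⟩
      rw [hα, (h 1).injective.eq_iff] at hx hy
      exact ⟨φ x, φ y, φ.injective.ne hxy, hx, hy⟩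
    · rintro ⟨x, y, hxy, hx, hy⟩
      refine ⟨φ.symm x, φ.symm y, φ.symm.injective.ne hxy, ?_, ?_⟩
      · rw [hα, Homeomorph.apply_symm_apply, hx]
      · rw [hα, Homeomorph.apply_symm_apply, hy]
  refine ⟨fun p => ⟨h 1 p, (hmem p).2 p.2⟩, ⟨fun p q e => ?_, fun q => ?_⟩, fun p => ?_⟩
  · exact Subtype.ext ((h 1).injective (congrArg Subtype.val e))
  · obtain ⟨p, hp⟩ := (h 1).surjective q
    exact ⟨⟨p, (hmem p).1 (by rw [hp]; exact q.2)⟩, Subtype.ext hp⟩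
  · set q : crossings β.toFun := ⟨h 1 p, (hmem p).2 p.2⟩ with hq
    obtain ⟨h1, h2, h3, h4, h5⟩ := β.params_spec q
    rw [hcurve] at h4 h5
    have hbase : curve α.toFun (g β.baseParam) = α.base := by
      apply (h 1).injective
      rw [← hcurve, β.curve_baseParam, hb]
    -- The lift `g` preserves order and carries base parameters to base parameters, so it matches
    -- first and second passages up to one integer.
    obtain ⟨n, e1, e2⟩ := α.params_unique hbase (g.strictMono h1) (g.strictMono h2)
      (by rw [← hg1]; exact g.strictMono h3) p ((h 1).injective h4) ((h 1).injective h5)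
    obtain ⟨s1, s2⟩ := α.smoothAt_params p
    refine ⟨?_, ?_, ?_⟩
    · have hne : (g (β.param₁ q) : UnitAddCircle) ≠ g (β.param₂ q) := by
        rw [← hg, ← hg]
        exact φ.injective.ne (β.coe_param_ne q)
      have := crossSign_eq_of_isotopy α.generic β.generic hc h0 g hcurve (β.coe_param_ne q) hne
        (by rw [hcurve, hcurve, h4, h5])
      rw [e1, e2, crossSign_add_int s1 s2] at this
      exact this
    -- The loop of `β` is viewed as running along `h 1 ∘ α` through the parametrization `g ∘ T`,
    -- over the same arc as the loop of `α`.
    · refine isotopic_of_traverses (f' := h 1 ∘ α.toFun) (α.traverses_inner p) ?_ hc h0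
        (fun _ => rfl) rfl
      obtain ⟨T, hT, hT1, hTc, hTr⟩ := β.traverses_inner q
      refine ⟨g ∘ T, g.strictMono.comp hT, fun u => ?_, fun u => ?_, ?_⟩
      · rw [Function.comp_apply, hT1, hg1, Function.comp_apply]
      · rw [hTc, hcurve]
        rfl
      · rw [Set.range_comp, hTr, PointedLoop.arc, image_arcSet g.strictMono hg1,
          g.surjective.range_eq, Set.univ_inter, e1, e2, arcSet_add_int]
        rfl
    · refine isotopic_of_traverses (f' := h 1 ∘ α.toFun) (α.traverses_outer p) ?_ hc h0
        (fun _ => rfl) hb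
      obtain ⟨T, hT, hT1, hTc, hTr⟩ := β.traverses_outer q
      refine ⟨g ∘ T, g.strictMono.comp hT, fun u => ?_, fun u => ?_, ?_⟩
      · rw [Function.comp_apply, hT1, hg1, Function.comp_apply]
      · rw [hTc, hcurve]
        rfl
      · rw [Set.range_comp, hTr, Set.image_compl_eq g.bijective, PointedLoop.arc,
          image_arcSet g.strictMono hg1, g.surjective.range_eq, Set.univ_inter, e1, e2,
          arcSet_add_int]
        rfl

theorem loopCoproduct_eq_of_isotopic (R : Type*) [CommRing R] [OrientedSurface M]
    {α β : PointedLoop M} (h : Isotopic α β) : loopCoproduct R α = loopCoproduct R β := by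
  obtain ⟨e, he, H⟩ := h.exists_crossings_bijective
  refine finsum_eq_of_bijective e he fun p => ?_
  obtain ⟨h1, h2, h3⟩ := H p
  rw [h1, gen_eq_of_isotopic R h2, gen_eq_of_isotopic R h3]

/-- The comultiplication `ρ` on the module of loops. -/
noncomputable def rho (R M : Type*) [CommRing R] [TopologicalSpace M]
    [ChartedSpace (EuclideanHalfSpace 2) M] [OrientedSurface M] :
    LoopModule R M →ₗ[R] LoopModule R M ⊗[R] LoopModule R M :=
  (Finsupp.linearCombination R (Quotient.lift (s := isotopySetoid M) (loopCoproduct R)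
    fun _ _ h => loopCoproduct_eq_of_isotopic R h) :
    (IsotopyClass M →₀ R) →ₗ[R] LoopModule R M ⊗[R] LoopModule R M)

theorem rho_gen (R : Type*) [CommRing R] [OrientedSurface M] (α : PointedLoop M) :
    rho R M (α.gen R) = loopCoproduct R α :=
  (Finsupp.linearCombination_single R _ _).trans (one_smul R (loopCoproduct R α))

theorem LoopModule.hom_ext {R : Type*} [CommRing R] {N : Type*} [AddCommGroup N] [Module R N]
    {F G : LoopModule R M →ₗ[R] N} (h : ∀ α : PointedLoop M, F (α.gen R) = G (α.gen R)) :
    F = G := by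
  refine Finsupp.lhom_ext' (M := R) (α := IsotopyClass M) fun x => LinearMap.ext_ring ?_
  induction x using Quotient.inductionOn with
  | h α => exact h α

end Loops

end SurfaceLoops

namespace SurfaceLoops

section Loops

variable {M : Type*} [TopologicalSpace M] [ChartedSpace (EuclideanHalfSpace 2) M]

/-! ### The pre-Lie identity -/

namespace PointedLoop

variable {α : PointedLoop M}

/-- Distinct crossings have distinct parameters. -/
theorem params_ne {p q : crossings α.toFun} (h : p ≠ q) : α.param₁ p ≠ α.param₁ q ∧
    α.param₁ p ≠ α.param₂ q ∧ α.param₂ p ≠ α.param₁ q ∧ α.param₂ p ≠ α.param₂ q := by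
  obtain ⟨-, -, -, h4, h5⟩ := α.params_spec p
  obtain ⟨-, -, -, h4', h5'⟩ := α.params_spec q
  refine ⟨fun e => h (Subtype.ext ?_), fun e => h (Subtype.ext ?_), fun e => h (Subtype.ext ?_),
    fun e => h (Subtype.ext ?_)⟩
  · rw [← h4, ← h4', e]
  · rw [← h4, ← h5', e]
  · rw [← h5, ← h4', e]
  · rw [← h5, ← h5', e]

theorem not_mem_crossings_inner_self (p : crossings α.toFun) :
    p.1 ∉ crossings (α.inner p).toFun :=
  (α.inner p).base_not_mem

theorem not_mem_crossings_outer_self (p : crossings α.toFun) :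
    p.1 ∉ crossings (α.outer p).toFun := fun h =>
  ((mem_crossings_outer_iff p p).1 h).1
    ((param_mem_arc_iff p p).1.2 ⟨le_rfl, (α.params_spec p).2.1⟩)

/-- If the arc of `p` is nested in that of `q`, both end points of the larger arc lie outside the
smaller one. -/
theorem mem_outer_of_mem_inner {p q : crossings α.toFun}
    (h : p.1 ∈ crossings (α.inner q).toFun) : q.1 ∈ crossings (α.outer p).toFun := by
  have hne : p ≠ q := by
    rintro rfl
    exact not_mem_crossings_inner_self p h
  rw [mem_crossings_inner_iff, (param_mem_arc_iff q p).1, (param_mem_arc_iff q p).2] at h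
  rw [mem_crossings_outer_iff, (param_mem_arc_iff p q).1, (param_mem_arc_iff p q).2]
  exact ⟨fun h' => (params_ne hne).1 (le_antisymm h'.1 h.1.1), fun h' => by linarith [h'.2, h.2.2]⟩

/-- When both parameters of `q` avoid the arc of `p`, the two arcs are either disjoint or nested
with `p` inside `q`; the second case is excluded. -/
theorem mem_outer_symm {p q : crossings α.toFun} (h : q.1 ∈ crossings (α.outer p).toFun)
    (h' : p.1 ∉ crossings (α.inner q).toFun) :
    p.1 ∈ crossings (α.outer q).toFun := by
  have hne : p ≠ q := by
    rintro rfl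
    exact not_mem_crossings_outer_self p h
  obtain ⟨n1, n2, n3, n4⟩ := params_ne hne
  obtain ⟨-, hp, -, -, -⟩ := α.params_spec p
  obtain ⟨-, hq, -, -, -⟩ := α.params_spec q
  rw [mem_crossings_inner_iff, (param_mem_arc_iff q p).1, (param_mem_arc_iff q p).2] at h'
  rw [mem_crossings_outer_iff, (param_mem_arc_iff p q).1, (param_mem_arc_iff p q).2] at h
  rw [mem_crossings_outer_iff, (param_mem_arc_iff q p).1, (param_mem_arc_iff q p).2]
  grind

theorem not_mem_inner_of_mem_outer {p q : crossings α.toFun}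
    (h : q.1 ∈ crossings (α.outer p).toFun) : q.1 ∉ crossings (α.inner p).toFun := by
  rw [mem_crossings_inner_iff]
  rw [mem_crossings_outer_iff] at h
  exact fun h' => h.1 h'.1

theorem arc_subset {p q : crossings α.toFun} (h : p.1 ∈ crossings (α.inner q).toFun) :
    α.arc p ⊆ α.arc q := by
  rw [mem_crossings_inner_iff, (param_mem_arc_iff q p).1, (param_mem_arc_iff q p).2] at h
  rintro x ⟨n, h1, h2⟩
  exact ⟨n, by linarith [h.1.1], by linarith [h.2.2]⟩

/-- If two translates of the arcs met, the one starting later would start inside the other. -/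
theorem arc_disjoint {p q : crossings α.toFun} (h : q.1 ∈ crossings (α.outer p).toFun)
    (h' : p.1 ∉ crossings (α.inner q).toFun) : Disjoint (α.arc p) (α.arc q) := by
  have h'' := mem_outer_symm h h'
  rw [mem_crossings_outer_iff] at h h''
  rw [Set.disjoint_left]
  rintro x ⟨n, h1, h2⟩ ⟨m, h3, h4⟩
  rcases le_total (α.param₁ p + n) (α.param₁ q + m) with hl | hl
  · refine h.1 ((add_int_mem_arcSet (m - n)).1 ⟨0, ?_, ?_⟩) <;> push_cast <;> linarith
  · refine h''.1 ((add_int_mem_arcSet (n - m)).1 ⟨0, ?_, ?_⟩) <;> push_cast <;> linarith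

end PointedLoop

/-! ### Comparison of the iterated coproducts, pair by pair -/

open PointedLoop

variable (R : Type*) [CommRing R] (α : PointedLoop M)

open Classical in
/-- The contribution of a pair of crossings to `(ρ ⊗ id) ρ`. -/
noncomputable def leftTerm (p q : crossings α.toFun) :
    LoopModule R M ⊗[R] (LoopModule R M ⊗[R] LoopModule R M) :=
  if h : q.1 ∈ crossings (α.inner p).toFun then
    (α.sign p * α.sign q) • (((α.inner p).inner ⟨q, h⟩).gen R ⊗ₜ[R]
      (((α.inner p).outer ⟨q, h⟩).gen R ⊗ₜ[R] (α.outer p).gen R))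
  else 0

open Classical in
/-- The contribution of a pair of crossings to `(id ⊗ ρ) ρ`. -/
noncomputable def rightTerm (p q : crossings α.toFun) :
    LoopModule R M ⊗[R] (LoopModule R M ⊗[R] LoopModule R M) :=
  if h : q.1 ∈ crossings (α.outer p).toFun then
    (α.sign p * α.sign q) • ((α.inner p).gen R ⊗ₜ[R]
      (((α.outer p).inner ⟨q, h⟩).gen R ⊗ₜ[R] ((α.outer p).outer ⟨q, h⟩).gen R))
  else 0

variable {α}

/-- In either order the cuts produce the arc of `p`, the arc of `q` without that of `p`, and the
complement of the arc of `q`, with the same base points. -/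
theorem leftTerm_eq_rightTerm {p q : crossings α.toFun} (h : p.1 ∈ crossings (α.inner q).toFun) :
    leftTerm R α q p = rightTerm R α p q := by
  have h' := mem_outer_of_mem_inner h
  have hsub := arc_subset h
  have e1 : ((α.inner q).inner ⟨p, h⟩).gen R = (α.inner p).gen R := by
    refine gen_eq_of_isotopic R (isotopic_of_traverses_same
      ((isSubloop_inner q).traverses_inner h p.2) ?_ rfl)
    rw [range_inner, Set.inter_eq_right.2 hsub]
    exact α.traverses_inner p
  have e2 : ((α.inner q).outer ⟨p, h⟩).gen R = ((α.outer p).inner ⟨q, h'⟩).gen R := by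
    refine gen_eq_of_isotopic R (isotopic_of_traverses_same
      ((isSubloop_inner q).traverses_outer h p.2) ?_ rfl)
    rw [range_inner, Set.inter_comm, ← range_outer]
    exact (isSubloop_outer p).traverses_inner h' q.2
  have e3 : (α.outer q).gen R = ((α.outer p).outer ⟨q, h'⟩).gen R := by
    refine gen_eq_of_isotopic R (isotopic_of_traverses_same (α.traverses_outer q) ?_ rfl)
    have := (isSubloop_outer p).traverses_outer h' q.2
    rwa [range_outer, Set.inter_eq_right.2 (Set.compl_subset_compl.2 hsub)] at this
  rw [leftTerm, rightTerm, dif_pos h, dif_pos h', e1, e2, e3, mul_comm]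

/-- For disjoint arcs the cuts do not interact: the three loops run along the two arcs and the
complement of their union, and only the order of the first two depends on which cut comes first. -/
theorem perm12_rightTerm {p q : crossings α.toFun} (h : q.1 ∈ crossings (α.outer p).toFun)
    (h' : p.1 ∉ crossings (α.inner q).toFun) :
    perm12 R (LoopModule R M) (rightTerm R α p q) = rightTerm R α q p := by
  have h'' := mem_outer_symm h h'
  have hdis := arc_disjoint h h'
  have key : ∀ {p q : crossings α.toFun} (h : q.1 ∈ crossings (α.outer p).toFun),
      Disjoint (α.arc p) (α.arc q) →
      ((α.outer p).inner ⟨q, h⟩).gen R = (α.inner q).gen R := by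
    intro p q h hdis
    refine gen_eq_of_isotopic R (isotopic_of_traverses_same
      ((isSubloop_outer p).traverses_inner h q.2) ?_ rfl)
    rw [range_outer, Set.inter_eq_right.2 hdis.subset_compl_left]
    exact α.traverses_inner q
  have e3 : ((α.outer p).outer ⟨q, h⟩).gen R = ((α.outer q).outer ⟨p, h''⟩).gen R := by
    refine gen_eq_of_isotopic R (isotopic_of_traverses_same
      ((isSubloop_outer p).traverses_outer h q.2) ?_ rfl)
    rw [range_outer, Set.inter_comm, ← range_outer]
    exact (isSubloop_outer q).traverses_outer h'' p.2
  rw [rightTerm, rightTerm, dif_pos h, dif_pos h'', key h hdis, key h'' hdis.symm, e3, map_zsmul,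
    mul_comm]
  rfl

/-- Case by case: nested arcs give zero on both sides, disjoint arcs are exchanged, linked arcs do
not contribute. -/
theorem perm12_leftTerm_sub_rightTerm (p q : crossings α.toFun) :
    perm12 R (LoopModule R M) (leftTerm R α q p - rightTerm R α p q) =
      leftTerm R α p q - rightTerm R α q p := by
  by_cases h1 : p.1 ∈ crossings (α.inner q).toFun
  · have h2 : q.1 ∉ crossings (α.inner p).toFun :=
      not_mem_inner_of_mem_outer (mem_outer_of_mem_inner h1)
    have h3 : p.1 ∉ crossings (α.outer q).toFun := fun h => not_mem_inner_of_mem_outer h h1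
    rw [leftTerm_eq_rightTerm R h1, sub_self, map_zero, leftTerm, rightTerm, dif_neg h2,
      dif_neg h3, sub_zero]
  by_cases h2 : q.1 ∈ crossings (α.inner p).toFun
  · have h3 : q.1 ∉ crossings (α.outer p).toFun := fun h => not_mem_inner_of_mem_outer h h2
    rw [leftTerm_eq_rightTerm R h2, sub_self, leftTerm, rightTerm, dif_neg h1, dif_neg h3,
      sub_zero, map_zero]
  rw [leftTerm, leftTerm, dif_neg h1, dif_neg h2, zero_sub, zero_sub, map_neg, neg_inj]
  by_cases h3 : q.1 ∈ crossings (α.outer p).toFun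
  · exact perm12_rightTerm R h3 h1
  · have h4 : p.1 ∉ crossings (α.outer q).toFun := fun h => h3 (mem_outer_symm h h2)
    rw [rightTerm, rightTerm, dif_neg h3, dif_neg h4, map_zero]

variable [OrientedSurface M] (α)

/-- Crossings of a subloop are crossings of `α` with the same sign, so the inner sum extends by zero
to all crossings of `α`. -/
theorem rTensor_rho_gen [T2Space M] [Fintype (crossings α.toFun)] :
    TensorProduct.assoc R _ _ _ ((rho R M).rTensor (LoopModule R M) (rho R M (α.gen R))) =
      ∑ p, ∑ q, leftTerm R α p q := by
  rw [rho_gen, loopCoproduct, finsum_eq_sum_of_fintype, map_sum, map_sum]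
  refine Finset.sum_congr rfl fun p _ => ?_
  have : Fintype (crossings (α.inner p).toFun) := (α.inner p).generic.finite_crossings.fintype
  rw [map_zsmul, LinearMap.rTensor_tmul, rho_gen, loopCoproduct, finsum_eq_sum_of_fintype,
    TensorProduct.sum_tmul, map_zsmul, map_sum, Finset.smul_sum]
  refine Fintype.sum_of_injective (fun q : crossings (α.inner p).toFun =>
    (⟨q, ((isSubloop_inner p).params q).1⟩ : crossings α.toFun))
    (fun q q' e => Subtype.ext (congrArg (fun z : crossings α.toFun => z.1) e)) _ _
    (fun q hq => ?_) fun q => ?_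
  · exact dif_neg fun h => hq ⟨⟨q, h⟩, rfl⟩
  · rw [leftTerm, dif_pos q.2, ← sign_inner p ⟨q.1, _⟩ q.2, mul_smul]
    refine congrArg (α.sign p • ·) ?_
    have e : ∀ (n : ℤ) (x : LoopModule R M ⊗[R] LoopModule R M) (y : LoopModule R M),
        (n • x) ⊗ₜ[R] y = n • (x ⊗ₜ[R] y) := fun n x y =>
      map_zsmul ((TensorProduct.mk R _ _).flip y) n x
    rw [e, map_zsmul, TensorProduct.assoc_tmul]

theorem lTensor_rho_gen [T2Space M] [Fintype (crossings α.toFun)] :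
    (rho R M).lTensor (LoopModule R M) (rho R M (α.gen R)) = ∑ p, ∑ q, rightTerm R α p q := by
  rw [rho_gen, loopCoproduct, finsum_eq_sum_of_fintype, map_sum]
  refine Finset.sum_congr rfl fun p _ => ?_
  have : Fintype (crossings (α.outer p).toFun) := (α.outer p).generic.finite_crossings.fintype
  rw [map_zsmul, LinearMap.lTensor_tmul, rho_gen, loopCoproduct, finsum_eq_sum_of_fintype,
    TensorProduct.tmul_sum, Finset.smul_sum]
  refine Fintype.sum_of_injective (fun q : crossings (α.outer p).toFun =>
    (⟨q, ((isSubloop_outer p).params q).1⟩ : crossings α.toFun))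
    (fun q q' e => Subtype.ext (congrArg (fun z : crossings α.toFun => z.1) e)) _ _
    (fun q hq => ?_) fun q => ?_
  · exact dif_neg fun h => hq ⟨⟨q, h⟩, rfl⟩
  · rw [rightTerm, dif_pos q.2, ← sign_outer p ⟨q.1, _⟩ q.2, mul_smul, TensorProduct.tmul_smul]

theorem isPreLieComultiplication_rho [T2Space M] : IsPreLieComultiplication (rho R M) := by
  refine LoopModule.hom_ext fun α => ?_
  have : Fintype (crossings α.toFun) := α.generic.finite_crossings.fintype
  -- The left sum is transposed, so that the two cuts of a nested pair meet in one summand and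
  -- cancel.
  have h : TensorProduct.assoc R _ _ _
      ((rho R M).rTensor (LoopModule R M) (rho R M (α.gen R))) -
      (rho R M).lTensor (LoopModule R M) (rho R M (α.gen R)) =
      ∑ p, ∑ q, (leftTerm R α q p - rightTerm R α p q) := by
    simp only [rTensor_rho_gen, lTensor_rho_gen, Finset.sum_sub_distrib]
    rw [Finset.sum_comm]
  refine (congrArg (LinearMap.id - perm12 R (LoopModule R M) :
    LoopModule R M ⊗[R] (LoopModule R M ⊗[R] LoopModule R M) →ₗ[R]
      LoopModule R M ⊗[R] (LoopModule R M ⊗[R] LoopModule R M)) h).trans ?_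
  rw [LinearMap.sub_apply, LinearMap.id_apply, LinearMap.zero_apply, sub_eq_zero]
  simp only [map_sum, perm12_leftTerm_sub_rightTerm]
  exact Finset.sum_comm

theorem antisymmetrization_rho_gen [T2Space M] : antisymmetrization (rho R M) (α.gen R) =
    ∑ᶠ p : crossings α.toFun, α.sign p • ((α.inner p).gen R ⊗ₜ[R] (α.outer p).gen R -
      (α.outer p).gen R ⊗ₜ[R] (α.inner p).gen R) := by
  have : Fintype (crossings α.toFun) := α.generic.finite_crossings.fintype
  rw [antisymmetrization, LinearMap.sub_apply, LinearMap.comp_apply, rho_gen, loopCoproduct,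
    finsum_eq_sum_of_fintype, finsum_eq_sum_of_fintype, map_sum, ← Finset.sum_sub_distrib]
  refine Finset.sum_congr rfl fun p _ => ?_
  rw [map_zsmul, ← smul_sub]
  rfl

end Loops

end SurfaceLoops

theorem mainTheorem5 (R : Type*) [CommRing R] (M : Type*) [TopologicalSpace M] [T2Space M]
    [ChartedSpace (EuclideanHalfSpace 2) M] [SurfaceLoops.OrientedSurface M] :
    (∀ α : SurfaceLoops.PointedLoop M, (SurfaceLoops.crossings α.toFun).Finite) ∧
    ∃ ρ : SurfaceLoops.LoopModule R M →ₗ[R]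
        SurfaceLoops.LoopModule R M ⊗[R] SurfaceLoops.LoopModule R M,
      (∀ α : SurfaceLoops.PointedLoop M,
        ρ (α.gen R) = ∑ᶠ p : SurfaceLoops.crossings α.toFun,
          α.sign p • ((α.inner p).gen R ⊗ₜ[R] (α.outer p).gen R)) ∧
      (∀ ρ' : SurfaceLoops.LoopModule R M →ₗ[R]
          SurfaceLoops.LoopModule R M ⊗[R] SurfaceLoops.LoopModule R M,
        (∀ α : SurfaceLoops.PointedLoop M,
          ρ' (α.gen R) = ∑ᶠ p : SurfaceLoops.crossings α.toFun,
            α.sign p • ((α.inner p).gen R ⊗ₜ[R] (α.outer p).gen R)) → ρ' = ρ) ∧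
      SurfaceLoops.IsPreLieComultiplication ρ ∧
      SurfaceLoops.IsLieCobracket (SurfaceLoops.antisymmetrization ρ) ∧
      (∀ α : SurfaceLoops.PointedLoop M,
        SurfaceLoops.antisymmetrization ρ (α.gen R) =
          ∑ᶠ p : SurfaceLoops.crossings α.toFun,
            α.sign p • ((α.inner p).gen R ⊗ₜ[R] (α.outer p).gen R -
              (α.outer p).gen R ⊗ₜ[R] (α.inner p).gen R)) := by
  have hpre := SurfaceLoops.isPreLieComultiplication_rho (M := M) R
  exact ⟨fun α => α.generic.finite_crossings, SurfaceLoops.rho R M, SurfaceLoops.rho_gen R,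
    fun ρ' h => SurfaceLoops.LoopModule.hom_ext fun α =>
      (h α).trans (SurfaceLoops.rho_gen R α).symm,
    hpre, hpre.isLieCobracket, fun α => SurfaceLoops.antisymmetrization_rho_gen R α⟩
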